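/- For a finite graph $G$ with $n$ vertices, the bisection width $BW(G)$ is the minimum, over all vertex sets $S$ with $|S|=\lfloor n/2\rfloor$, of the number of edges of $G$ joining $S$ to its complement. Let $d\ge 1$ and let $k_1\ge k_2\ge\dots\ge k_d\ge 2$ be integers. For each $i$ let $G_i$ be a graph on $k_i$ vertices that is either the path $P_{k_i}$ or (possible only when $k_i=2^{j}-1$ for some $j$) the complete binary tree with $k_i$ vertices, in which all $j$ levels are full. Let $\mathit{MCTP}^{(d)}_{k_1,\dots,k_d}=G_1\times\dots\times G_d$ be the Cartesian product: two $d$-tuples are adjacent if and only if they differ in exactly one coordinate $i$ and their $i$-th coordinates are adjacent in $G_i$. Then $$BW\big(\mathit{MCTP}^{(d)}_{k_1,\dots,k_d}\big)=\sum_{i=1}^{e} C_i,\qquad C_i=\prod_{j=i+1}^{d}k_j,$$ where $e$ is the least index $i$ with $k_i$ even, and $e=d$ if all $k_i$ are odd. -/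

import Mathlib

namespace MCTP

/-- The number of edges of `G` that join a vertex of `S` to a vertex outside `S`.
(`interedges S Sᶜ` is the set of pairs `(u, v)` of adjacent vertices with `u ∈ S`, `v ∉ S`,
so every edge of the cut is counted exactly once.) -/
noncomputable def cutSize {V : Type*} [Fintype V] (G : SimpleGraph V) (S : Finset V) : ℕ :=
  open Classical in (G.interedges S Sᶜ).card

/-- The bisection width: the minimum of the cut size over all sets of `⌊n / 2⌋` vertices,
`n` being the number of vertices (such sets always exist). -/
noncomputable def bisectionWidth {V : Type*} [Fintype V] (G : SimpleGraph V) : ℕ :=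
  sInf {c : ℕ | ∃ S : Finset V, S.card = Fintype.card V / 2 ∧ cutSize G S = c}

/-- The Cartesian product of `d` graphs: two vertices are adjacent iff they are adjacent in one
coordinate and agree in all the others. -/
def cartesianProduct {d : ℕ} {V : Fin d → Type*} (G : ∀ i, SimpleGraph (V i)) :
    SimpleGraph (∀ i, V i) where
  Adj x y := ∃ i, (G i).Adj (x i) (y i) ∧ ∀ j, j ≠ i → x j = y j
  symm := ⟨fun _ _ ⟨i, h, h'⟩ => ⟨i, h.symm, fun j hj => (h' j hj).symm⟩⟩
  loopless := ⟨fun _ ⟨_, h, _⟩ => h.ne rfl⟩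

/-- The binary tree on `{0, …, k - 1}` in level order: the root is `0` and the children
of `v` are `2 v + 1` and `2 v + 2`. For `k = 2 ^ j - 1` it is the complete
binary tree with `j` (full) levels. -/
def binaryTree (k : ℕ) : SimpleGraph (Fin k) :=
  SimpleGraph.fromRel fun u v => (v : ℕ) = 2 * u + 1 ∨ (v : ℕ) = 2 * u + 2

/-- `G` is the complete binary tree on `k` vertices; in particular `k = 2 ^ j - 1` for
some `j ≥ 1`. -/
def IsCompleteBinaryTree {k : ℕ} (G : SimpleGraph (Fin k)) : Prop :=
  (∃ j : ℕ, 1 ≤ j ∧ k = 2 ^ j - 1) ∧ G = binaryTree k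

/-- `G` is the path on `k` vertices. -/
def IsPathGraph {k : ℕ} (G : SimpleGraph (Fin k)) : Prop :=
  G = SimpleGraph.pathGraph k

/-- The lowest dimension `e` (dimensions being numbered `1, …, d`) with an even number of
vertices, and `e = d` if there is none. The index `i : Fin d` stands for dimension `i + 1`. -/
noncomputable def lowestEvenDim {d : ℕ} (k : Fin d → ℕ) : ℕ :=
  open Classical in
  if ∃ i, Even (k i) then sInf {m : ℕ | ∃ i : Fin d, Even (k i) ∧ m = (i : ℕ) + 1} else d

/-- `C_i`, the product of the `k_j` over all `j > i`. -/
def C {d : ℕ} (k : Fin d → ℕ) (i : Fin d) : ℕ := ∏ j ∈ Finset.Ioi i, k j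

/-- `Ψ(e)`, the sum of `C_i` over the dimensions `1, …, e`. -/
def Psi {d : ℕ} (k : Fin d → ℕ) (e : ℕ) : ℕ :=
  ∑ i ∈ Finset.univ.filter (fun i : Fin d => (i : ℕ) + 1 ≤ e), C k i

end MCTP

namespace MCTP

open Finset

/-! The lower bound compares the cut with a weighted product of cliques. A line in direction `i`
meeting `S` in `c` points is cut at least once unless `c` is `0` or `k i`, because `G i` is
connected, so it contributes at least `lineBoundary (k i) c`, that is `c (k i - c)` divided by its
largest possible value `⌊(k i)² / 4⌋`. The normalization makes the comparison sharp for lines that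
are empty, full or cut in the middle, and these are the only lines occurring in a lexicographic
half.

What remains is a weighted edge-isoperimetric theorem: with sides in decreasing order and the
longest coordinate slowest, initial segments of the lexicographic order minimize the weighted
boundary, whose value is `lexBoundary`. Slicing along the first coordinate reduces this to an
inequality between slice sizes (`lexBoundary_le_of_slices`), which for sizes in decreasing order is
linear in the interaction of slices (`LexOptimal`). `lexOptimal` proves it by induction. Each slice
is cut into columns, giving an antitone array on a `k₁ × k₂` grid whose entries count points of
blocks of size `N = L.prod`. Compressing rows and columns by the induction hypothesis, then merging
incomparable partial cells by subadditivity of `lexBoundary` modulo `N`, leaves at most one partial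
cell (`lexBoundary_le_gridEnergy`). Such an array interpolates between two 0-1 arrays, so the
two-dimensional case `lexBoundary_pair_le` finishes.

The two-dimensional case rests on edge-isoperimetry in a square product of cliques
(`sum_min_add_sum_sq_le`), extended to `T ≥ k` columns by averaging over deleted columns
(`le_pairEnergy`).

At half the points `lexBoundary` equals the claimed sum (`lexBoundary_half`). The bound is attained
because paths and complete binary trees can be cut by one edge in the middle, on either side of a
middle vertex when the order is odd (`exists_cutSize_eq`). -/

/-! ### Edge-isoperimetry in a product of two cliques -/

/-- Twice the number of edges plus twice the number of vertices of the column-by-column initial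
segment with `m` cells of a grid with columns of height `k`, all lines being cliques. -/
def segmentEnergy (k m : ℤ) : ℤ :=
  k * (m / k) ^ 2 + 2 * (m / k) * (m % k) + m % k + (m / k) * k ^ 2 + (m % k) ^ 2

/-- A new full column contributes `k ^ 2 + k` by itself and `2 * m` through its rows shared with the
old cells. -/
lemma segmentEnergy_add_self {k : ℤ} (hk : 0 < k) (m : ℤ) :
    segmentEnergy k (m + k) = segmentEnergy k m + k ^ 2 + k + 2 * m := by
  have h1 : (m + k) / k = m / k + 1 := Int.add_ediv_of_dvd_right (dvd_refl k) |>.trans (by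
    rw [Int.ediv_self hk.ne'])
  have h2 : (m + k) % k = m % k := Int.add_emod_right m k
  have h3 := Int.mul_ediv_add_emod m k
  simp only [segmentEnergy, h1, h2]
  linear_combination 2 * h3

lemma segmentEnergy_of_lt {k m : ℤ} (h0 : 0 ≤ m) (h1 : m < k) : segmentEnergy k m = m + m ^ 2 := by
  simp [segmentEnergy, Int.ediv_eq_zero_of_lt h0 h1, Int.emod_eq_of_lt h0 h1]

/-- Adding a bottom row of length `j` to an initial segment with columns of height `κ` does not
give more than the initial segment with columns of height `κ + 1`. -/
lemma segmentEnergy_succ_height (j : ℕ) {κ : ℤ} (hκ : 0 < κ) :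
    ∀ m : ℤ, (j : ℤ) ≤ κ → 0 ≤ m → m ≤ j * κ →
      segmentEnergy κ m + j ^ 2 + j + 2 * m ≤ segmentEnergy (κ + 1) (m + j) := by
  induction j with
  | zero =>
    intro m _ h0 h1
    obtain rfl : m = 0 := by simp at h1; omega
    simp [segmentEnergy]
  | succ j ih =>
    intro m hj h0 h1
    push_cast at hj h1 ⊢
    -- A full column of height `κ` together with its new bottom cell is a full column of height `κ +
    -- 1`; removing it on both sides leaves a row of length `j`.
    by_cases hm : κ ≤ m
    · have := ih (m - κ) (by omega) (by omega) (by linarith)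
      have e1 := segmentEnergy_add_self hκ (m - κ)
      have e2 := segmentEnergy_add_self (k := κ + 1) (by omega) (m - κ + j)
      rw [sub_add_cancel] at e1
      rw [show m - κ + j + (κ + 1) = m + (j + 1) by ring] at e2
      rw [e1, e2]
      nlinarith
    · push Not at hm
      rw [segmentEnergy_of_lt h0 hm]
      by_cases hs : m + (j + 1) < κ + 1
      · rw [segmentEnergy_of_lt (by omega) hs]
        have : 0 ≤ m * j := by positivity
        nlinarith
      · push Not at hs
        have e2 := segmentEnergy_add_self (k := κ + 1) (by omega) (m + (j + 1) - (κ + 1))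
        rw [sub_add_cancel] at e2
        rw [e2, segmentEnergy_of_lt (by omega) (by omega)]
        have : 0 ≤ (κ - j) * (κ - m) := mul_nonneg (by omega) (by omega)
        nlinarith

/-- The edge-isoperimetric inequality for `K_j □ K_k`, `j ≤ k`, in terms of column sizes. -/
theorem sum_min_add_sum_sq_le {ι : Type*} [DecidableEq ι] (k : ℕ) :
    ∀ (s : Finset ι) (a : ι → ℤ), (∀ t ∈ s, 0 ≤ a t ∧ a t ≤ k) → s.card ≤ k →
      ∑ t ∈ s, ∑ u ∈ s, min (a t) (a u) + ∑ t ∈ s, a t ^ 2 ≤ segmentEnergy k (∑ t ∈ s, a t) := by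
  induction k with
  | zero =>
    intro s a _ hs
    obtain rfl : s = ∅ := by simpa using hs
    simp [segmentEnergy]
  | succ k ihk =>
    -- The measure counts columns as well as cells, so that deleting an empty column also decreases
    -- it.
    suffices H : ∀ (n : ℕ) (s : Finset ι) (a : ι → ℤ),
        (∀ t ∈ s, 0 ≤ a t ∧ a t ≤ (k + 1 : ℕ)) → s.card ≤ k + 1 →
        (s.card : ℤ) + ∑ t ∈ s, a t = n →
        ∑ t ∈ s, ∑ u ∈ s, min (a t) (a u) + ∑ t ∈ s, a t ^ 2 ≤
          segmentEnergy (k + 1 : ℕ) (∑ t ∈ s, a t) by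
      intro s a ha hs
      have h0 : 0 ≤ (s.card : ℤ) + ∑ t ∈ s, a t :=
        add_nonneg (by positivity) (sum_nonneg fun t ht => (ha t ht).1)
      exact H ((s.card : ℤ) + ∑ t ∈ s, a t).toNat s a ha hs (by omega)
    intro n
    induction n using Nat.strong_induction_on with
    | _ n ih =>
    intro s a ha hs hn
    -- removing one column
    have split : ∀ x ∈ s, ∑ t ∈ s, ∑ u ∈ s, min (a t) (a u) =
        ∑ t ∈ s.erase x, ∑ u ∈ s.erase x, min (a t) (a u) +
          2 * ∑ t ∈ s.erase x, min (a x) (a t) + a x := by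
      intro x hx
      rw [← add_sum_erase s _ hx, ← add_sum_erase s _ hx]
      rw [sum_congr rfl fun t (_ : t ∈ s.erase x) => (add_sum_erase s _ hx).symm]
      rw [sum_add_distrib, sum_congr rfl fun t (_ : t ∈ s.erase x) => min_comm (a t) (a x)]
      simp only [min_self]
      ring
    have hlt : ∀ x ∈ s, ∃ n' < n, ((s.erase x).card : ℤ) + ∑ t ∈ s.erase x, a t = (n' : ℕ) := by
      intro x hx
      have h1 := card_erase_of_mem hx
      have h2 := add_sum_erase s a hx
      have h3 := card_pos.2 ⟨x, hx⟩
      have h4 := (ha x hx).1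
      have h5 : 0 ≤ ∑ t ∈ s.erase x, a t :=
        sum_nonneg fun t ht => (ha t (mem_of_mem_erase ht)).1
      exact ⟨((s.erase x).card + ∑ t ∈ s.erase x, a t).toNat, by omega, by omega⟩
    have drop : ∀ x ∈ s, ∑ t ∈ s.erase x, ∑ u ∈ s.erase x, min (a t) (a u) +
        ∑ t ∈ s.erase x, a t ^ 2 ≤ segmentEnergy (k + 1 : ℕ) (∑ t ∈ s.erase x, a t) := by
      intro x hx
      obtain ⟨n', hn', e⟩ := hlt x hx
      exact ih n' hn' _ a (fun t ht => ha t (mem_of_mem_erase ht))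
        ((card_le_card (erase_subset _ _)).trans hs) e
    by_cases hz : ∃ x ∈ s, a x = 0
    · obtain ⟨x, hx, h0⟩ := hz
      rw [split x hx, ← add_sum_erase s (fun t => a t ^ 2) hx, ← add_sum_erase s a hx, h0,
        sum_congr rfl fun t ht => min_eq_left ((ha t (mem_of_mem_erase ht)).1)]
      simpa using drop x hx
    by_cases hf : ∃ x ∈ s, a x = (k + 1 : ℕ)
    · obtain ⟨x, hx, h0⟩ := hf
      have := drop x hx
      rw [split x hx, ← add_sum_erase s (fun t => a t ^ 2) hx, ← add_sum_erase s a hx, h0,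
        sum_congr rfl fun t ht => min_eq_right ((ha t (mem_of_mem_erase ht)).2),
        add_comm ((k + 1 : ℕ) : ℤ), segmentEnergy_add_self (by positivity)]
      linarith
    push Not at hz hf
    rcases s.eq_empty_or_nonempty with rfl | hne
    · simp [segmentEnergy]
    have hb : ∀ t ∈ s, 0 ≤ a t - 1 ∧ a t - 1 + 1 ≤ k := by
      intro t ht
      have h1 := ha t ht
      have h2 := hz t ht
      have h3 := hf t ht
      push_cast at h1 h3
      omega
    have hsum : ∑ t ∈ s, a t = ∑ t ∈ s, (a t - 1) + s.card := by
      simp [sum_sub_distrib]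
    have hshift : ∑ t ∈ s, ∑ u ∈ s, min (a t) (a u) + ∑ t ∈ s, a t ^ 2 =
        ∑ t ∈ s, ∑ u ∈ s, min (a t - 1) (a u - 1) + ∑ t ∈ s, (a t - 1) ^ 2 +
          (s.card ^ 2 + s.card + 2 * ∑ t ∈ s, (a t - 1)) := by
      have e1 : ∑ t ∈ s, ∑ u ∈ s, min (a t) (a u) =
          ∑ t ∈ s, ∑ u ∈ s, min (a t - 1) (a u - 1) + (s.card : ℤ) ^ 2 := by
        simp only [min_sub_sub_right, sum_sub_distrib, sum_const]
        simp
        ring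
      have e2 : ∑ t ∈ s, a t ^ 2 = ∑ t ∈ s, (a t - 1) ^ 2 + 2 * ∑ t ∈ s, (a t - 1) + s.card := by
        rw [mul_sum, ← sum_add_distrib, card_eq_sum_ones, Nat.cast_sum, ← sum_add_distrib]
        exact sum_congr rfl fun t _ => by push_cast; ring
      rw [e1, e2]
      ring
    have hpos : 0 ≤ ∑ t ∈ s, (a t - 1) := sum_nonneg fun t ht => (hb t ht).1
    have hcard := hne.card_pos
    rw [hshift]
    -- All columns now have between `1` and `k` cells, and the bottom row is stripped off. With `k +
    -- 1` columns this row is a full line, worth as much as a full column. With fewer columns the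
    -- rest fits into height `k`, where the outer induction applies, and `segmentEnergy_succ_height`
    -- restores the row.
    rcases hs.eq_or_lt with hs' | hs'
    · have := ih (n - s.card) (by omega) s (fun t => a t - 1)
        (fun t ht => ⟨(hb t ht).1, by have := (hb t ht).2; push_cast; linarith⟩) hs (by omega)
      rw [hsum]
      rw [hs', segmentEnergy_add_self (by positivity)]
      linarith
    · have h1 := ihk s (fun t => a t - 1) (fun t ht => ⟨(hb t ht).1, by linarith [(hb t ht).2]⟩)
        (by omega)
      have h2 := segmentEnergy_succ_height s.card (κ := k) (by omega) (∑ t ∈ s, (a t - 1))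
        (by omega) hpos (by
          rw [← nsmul_eq_mul]
          exact sum_le_card_nsmul _ _ _ fun t ht => by linarith [(hb t ht).2])
      rw [hsum]
      push_cast
      linarith

/-! ### The energy inequality for at least as many columns as rows -/

/-- `r (k - r)` for the remainder `r` of `m` modulo `k`. -/
def remProd (k m : ℤ) : ℤ := (m % k) * (k - m % k)

lemma remProd_add_le {k : ℤ} (hk : 0 < k) (m x : ℤ) (h0 : 0 ≤ x) (hx : x ≤ k) :
    remProd k (m + x) ≤ remProd k m + x * (k - x) := by
  have hr0 := Int.emod_nonneg m hk.ne'
  have hr1 := Int.emod_lt_of_pos m hk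
  have e : (m + x) % k = (m % k + x) % k := by simp
  simp only [remProd, e]
  generalize m % k = r at *
  rcases lt_or_ge (r + x) k with h | h
  · rw [Int.emod_eq_of_lt (by omega) h]
    nlinarith [mul_nonneg hr0 h0]
  rcases lt_or_ge (r + x) (k + k) with h' | h'
  · rw [← Int.sub_emod_right, Int.emod_eq_of_lt (by omega) (by omega)]
    nlinarith [mul_nonneg (sub_nonneg.2 hr1.le) (sub_nonneg.2 hx)]
  · omega

lemma remProd_sum_le {ι : Type*} {k : ℤ} (hk : 0 < k) (s : Finset ι) (a : ι → ℤ)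
    (ha : ∀ t ∈ s, 0 ≤ a t ∧ a t ≤ k) :
    remProd k (∑ t ∈ s, a t) ≤ ∑ t ∈ s, a t * (k - a t) := by
  classical
  induction s using Finset.induction_on with
  | empty => simp [remProd]
  | insert x s hx ih =>
    rw [sum_insert hx, sum_insert hx, add_comm]
    have h := ha x (mem_insert_self _ _)
    have := remProd_add_le hk (∑ t ∈ s, a t) (a x) h.1 h.2
    linarith [ih fun t ht => ha t (mem_insert_of_mem ht)]

lemma sum_sum_abs_sub {ι : Type*} (s : Finset ι) (a : ι → ℤ) :
    ∑ t ∈ s, ∑ u ∈ s, |a t - a u| =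
      2 * s.card * ∑ t ∈ s, a t - 2 * ∑ t ∈ s, ∑ u ∈ s, min (a t) (a u) := by
  have : ∀ t u, |a t - a u| = a t + a u - 2 * min (a t) (a u) := by
    intro t u
    rcases le_total (a t) (a u) with h | h
    · rw [min_eq_left h, abs_of_nonpos (by linarith)]; ring
    · rw [min_eq_right h, abs_of_nonneg (by linarith)]; ring
  simp only [this, sum_sub_distrib, sum_add_distrib, sum_const, ← mul_sum, nsmul_eq_mul]
  ring

lemma sum_sum_sub_sq {ι R : Type*} [CommRing R] (s : Finset ι) (a : ι → R) :
    ∑ t ∈ s, ∑ u ∈ s, (a t - a u) ^ 2 =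
      2 * s.card * ∑ t ∈ s, a t ^ 2 - 2 * (∑ t ∈ s, a t) ^ 2 := by
  simp only [sub_sq, sum_sub_distrib, sum_add_distrib, sum_const, ← mul_sum, ← sum_mul,
    nsmul_eq_mul]
  ring

/-- The energy of points on a cycle of length `k`. -/
def pairEnergy {ι : Type*} (k : ℤ) (s : Finset ι) (a : ι → ℤ) : ℤ :=
  ∑ t ∈ s, ∑ u ∈ s, |a t - a u| * (k - |a t - a u|)

lemma pairEnergy_eq {ι : Type*} (k : ℤ) (s : Finset ι) (a : ι → ℤ) :
    pairEnergy k s a = k * ∑ t ∈ s, ∑ u ∈ s, |a t - a u| -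
      (2 * s.card * ∑ t ∈ s, a t ^ 2 - 2 * (∑ t ∈ s, a t) ^ 2) := by
  rw [← sum_sum_sub_sq, mul_sum, ← sum_sub_distrib]
  refine sum_congr rfl fun t _ => ?_
  rw [mul_sum, ← sum_sub_distrib]
  refine sum_congr rfl fun u _ => ?_
  rw [← sq_abs (a t - a u)]
  ring

/-- When the number of columns is `k`, `pairEnergy` depends only on the total and, with a negative
coefficient, on the quantity bounded above by `sum_min_add_sum_sq_le`. -/
lemma le_pairEnergy_of_card_eq {ι : Type*} {k : ℕ} (hk : 0 < k) (s : Finset ι) (a : ι → ℤ)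
    (ha : ∀ t ∈ s, 0 ≤ a t ∧ a t ≤ k) (hs : s.card = k) :
    2 * (k - 1) * remProd k (∑ t ∈ s, a t) ≤ pairEnergy k s a := by
  classical
  have h := sum_min_add_sum_sq_le k s a ha hs.le
  rw [pairEnergy_eq, sum_sum_abs_sub, hs]
  set m := ∑ t ∈ s, a t
  have hm := Int.mul_ediv_add_emod m k
  have hk' : (0 : ℤ) < k := by exact_mod_cast hk
  have h' := mul_le_mul_of_nonneg_left h hk'.le
  simp only [segmentEnergy] at h'
  simp only [remProd]
  generalize m / (k : ℤ) = p at *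
  generalize m % (k : ℤ) = r at *
  rw [← hm]
  linarith

/-- Averaging: the bound for `T` columns is applied after each deletion of one of `T + 1` columns.
The deleted column is put back into the remainder term by `remProd_add_le`. -/
lemma le_pairEnergy {ι : Type*} {k : ℕ} (hk : 2 ≤ k) (T : ℕ) (hT : k ≤ T) :
    ∀ (s : Finset ι) (a : ι → ℤ), (∀ t ∈ s, 0 ≤ a t ∧ a t ≤ k) → s.card = T →
    2 * T * (T - 1) * remProd k (∑ t ∈ s, a t) ≤
      2 * (T - 1) * (T - k) * ∑ t ∈ s, a t * (k - a t) + k * pairEnergy k s a := by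
  classical
  have hk' : (0 : ℤ) < k := by exact_mod_cast (by omega : 0 < k)
  induction T, hT using Nat.le_induction with
  | base =>
    intro s a ha hs
    have := mul_le_mul_of_nonneg_left (le_pairEnergy_of_card_eq (by omega) s a ha hs) hk'.le
    linarith
  | succ T hT ih =>
    intro s a ha hs
    set m := ∑ t ∈ s, a t with hm
    set X := ∑ t ∈ s, a t * (k - a t) with hX
    have key : ∀ i ∈ s, 2 * (T : ℤ) * (T - 1) * (remProd k m - a i * (k - a i)) ≤
        2 * (T - 1) * (T - k) * (X - a i * (k - a i)) +
          k * (pairEnergy k s a - 2 * ∑ u ∈ s, |a i - a u| * (k - |a i - a u|)) := by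
      intro i hi
      have h1 := ih (s.erase i) a (fun t ht => ha t (mem_of_mem_erase ht))
        (by rw [card_erase_of_mem hi, hs]; rfl)
      have h2 := remProd_add_le hk' (∑ t ∈ s.erase i, a t) (a i) (ha i hi).1 (ha i hi).2
      rw [sum_erase_add s a hi] at h2
      have h3 : ∑ t ∈ s.erase i, a t * (k - a t) = X - a i * (k - a i) := by
        rw [hX, ← add_sum_erase s _ hi]; ring
      have h4 : pairEnergy k (s.erase i) a =
          pairEnergy k s a - 2 * ∑ u ∈ s, |a i - a u| * (k - |a i - a u|) := by
        have : ∀ t, ∑ u ∈ s, |a t - a u| * (k - |a t - a u|) =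
            |a t - a i| * (k - |a t - a i|) +
              ∑ u ∈ s.erase i, |a t - a u| * (k - |a t - a u|) :=
          fun t => (add_sum_erase s _ hi).symm
        simp only [pairEnergy]
        rw [← add_sum_erase s (fun t => ∑ u ∈ s, |a t - a u| * (k - |a t - a u|)) hi]
        simp only [this, sum_add_distrib, abs_sub_comm _ (a i)]
        simp
        ring
      rw [h3, h4] at h1
      have h5 : 0 ≤ 2 * (T : ℤ) * (T - 1) :=
        mul_nonneg (by positivity) (by have : 1 ≤ T := by omega
                                       exact_mod_cast (by omega : (0 : ℤ) ≤ (T : ℤ) - 1))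
      exact (mul_le_mul_of_nonneg_left (by linarith) h5).trans h1
    have hsum := sum_le_sum key
    have e1 : ∑ i ∈ s, ∑ u ∈ s, |a i - a u| * (k - |a i - a u|) = pairEnergy k s a := rfl
    simp only [← mul_sum, sum_add_distrib, sum_sub_distrib, sum_const, hs, e1, ← hX,
      nsmul_eq_mul] at hsum
    -- Each pair of columns survives `T - 1` of the `T + 1` deletions, which produces this common
    -- factor.
    have hT1 : (0 : ℤ) < T - 1 := by omega
    refine le_of_mul_le_mul_left ?_ hT1
    push_cast at hsum ⊢
    linarith

/-- The energy inequality behind the two-dimensional case. -/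
lemma le_energy {ι : Type*} {k T : ℕ} (hk : 2 ≤ k) (hT : k ≤ T) (s : Finset ι) (a : ι → ℤ)
    (ha : ∀ t ∈ s, 0 ≤ a t ∧ a t ≤ k) (hs : s.card = T) :
    2 * ((k * (T ^ 2 / 4 : ℕ) : ℤ) - (k ^ 2 / 4 : ℕ)) * remProd k (∑ t ∈ s, a t) ≤
      2 * ((k * (T ^ 2 / 4 : ℕ) : ℤ) - T * (k ^ 2 / 4 : ℕ)) * ∑ t ∈ s, a t * (k - a t) +
        (k ^ 2 / 4 : ℕ) * pairEnergy k s a := by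
  have hk' : (0 : ℤ) < k := by exact_mod_cast (by omega : 0 < k)
  have hX := remProd_sum_le hk' s a ha
  have hY := le_pairEnergy hk T hT s a ha hs
  generalize hw : k ^ 2 / 4 = w at *
  generalize hv : T ^ 2 / 4 = v at *
  rcases hT.eq_or_lt with rfl | hT'
  · obtain rfl : w = v := by omega
    have := mul_le_mul_of_nonneg_left (le_pairEnergy_of_card_eq (by omega) s a ha hs)
      (Int.natCast_nonneg w)
    linarith
  · refine le_of_mul_le_mul_left ?_ hk'
    have h1 := mul_le_mul_of_nonneg_left hY (Int.natCast_nonneg w)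
    -- Subtracting `w` times `le_pairEnergy` from `k` times the goal leaves `remProd_sum_le`
    -- multiplied by twice this coefficient. It is nonnegative because `T > k` gives `T ^ 2 - T + k
    -- ≤ T ^ 2 - 1 ≤ 4 * v`, while `4 * w ≤ k ^ 2`.
    have h2 : 0 ≤ (k : ℤ) ^ 2 * v - w * (T ^ 2 - T + k) := by
      have hw4 : 4 * (w : ℤ) ≤ k ^ 2 := by
        have : 4 * w ≤ k ^ 2 := by omega
        exact_mod_cast this
      have hv4 : (T : ℤ) ^ 2 ≤ 4 * v + 1 := by
        have h3 : T ^ 2 % 4 ≤ 1 := by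
          rcases Nat.even_or_odd' T with ⟨c, rfl | rfl⟩
          · rw [show (2 * c) ^ 2 = 4 * c ^ 2 by ring]; omega
          · rw [show (2 * c + 1) ^ 2 = 4 * (c ^ 2 + c) + 1 by ring]; omega
        have : T ^ 2 ≤ 4 * v + 1 := by omega
        exact_mod_cast this
      have hTk : (k : ℤ) + 1 ≤ T := by exact_mod_cast hT'
      have hTT : 0 ≤ (T : ℤ) ^ 2 - T + k := by nlinarith
      have := mul_le_mul_of_nonneg_right hw4 hTT
      nlinarith [mul_nonneg (sq_nonneg (k : ℤ)) (by linarith : (0 : ℤ) ≤ 4 * v - (T ^ 2 - T + k))]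
    have h3 := mul_le_mul_of_nonneg_left hX h2
    nlinarith

/-! ### Lexicographic boundaries and their subadditivity -/

/-- The normalized boundary `c (k - c) / ⌊k² / 4⌋` of `c` points on a line with `k` points. -/
def lineBoundary (k : ℕ) (c : ℚ) : ℚ := c * (k - c) / (k ^ 2 / 4 : ℕ)

/-- The normalized boundary of the initial segment with `m` points, in lexicographic order, of the
box whose side lengths are listed from the slowest to the fastest coordinate. -/
def lexBoundary : List ℕ → ℕ → ℚ
  | [], _ => 0
  | k :: L, m => (m % L.prod : ℕ) * lineBoundary k ((m / L.prod : ℕ) + 1) +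
      (L.prod - (m % L.prod : ℕ)) * lineBoundary k (m / L.prod : ℕ) + lexBoundary L (m % L.prod)

lemma quarter_pos {k : ℕ} (hk : 2 ≤ k) : (0 : ℚ) < (k ^ 2 / 4 : ℕ) := by
  have : 0 < k ^ 2 / 4 := Nat.div_pos (by nlinarith) (by norm_num)
  exact_mod_cast this

@[simp] lemma lineBoundary_zero (k : ℕ) : lineBoundary k 0 = 0 := by simp [lineBoundary]

@[simp] lemma lineBoundary_self (k : ℕ) : lineBoundary k k = 0 := by simp [lineBoundary]

lemma lineBoundary_add_le (k : ℕ) {p q : ℚ} (hp : 0 ≤ p) (hq : 0 ≤ q) :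
    lineBoundary k (p + q) ≤ lineBoundary k p + lineBoundary k q := by
  simp only [lineBoundary, ← add_div]
  gcongr
  nlinarith [mul_nonneg hp hq]

/-- This is `lineBoundary_add_le` after the complement `c ↦ k - c`. -/
lemma lineBoundary_add_sub_le (k : ℕ) {p q : ℚ} (hp : p ≤ k) (hq : q ≤ k) :
    lineBoundary k (p + q - k) ≤ lineBoundary k p + lineBoundary k q := by
  simp only [lineBoundary, ← add_div]
  gcongr
  nlinarith [mul_nonneg (sub_nonneg.2 hp) (sub_nonneg.2 hq)]

@[simp] lemma lexBoundary_zero (L : List ℕ) : lexBoundary L 0 = 0 := by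
  induction L with
  | nil => rfl
  | cons k L ih => simp [lexBoundary, ih]

lemma prod_pos_of_two_le {L : List ℕ} (hL : ∀ k ∈ L, 2 ≤ k) : 0 < L.prod :=
  List.prod_pos fun k hk => by have := hL k hk; omega

lemma lexBoundary_prod {L : List ℕ} (hL : ∀ k ∈ L, 2 ≤ k) : lexBoundary L L.prod = 0 := by
  cases L with
  | nil => rfl
  | cons k L =>
    have h := prod_pos_of_two_le fun x hx => hL x (List.mem_cons_of_mem _ hx)
    simp [lexBoundary, Nat.mul_div_cancel _ h]

/-- The case `r = L.prod` is allowed: a full last block and an empty next block give the same value,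
since full and empty boxes have no boundary. -/
lemma lexBoundary_cons {k : ℕ} {L : List ℕ} (hL : ∀ k ∈ L, 2 ≤ k) (p : ℕ) {r : ℕ}
    (hr : r ≤ L.prod) : lexBoundary (k :: L) (p * L.prod + r) =
      r * lineBoundary k (p + 1) + (L.prod - r) * lineBoundary k p + lexBoundary L r := by
  have h := prod_pos_of_two_le hL
  rcases hr.eq_or_lt with rfl | hr
  · have e : p * L.prod + L.prod = (p + 1) * L.prod := by ring
    rw [lexBoundary, e, Nat.mul_div_cancel _ h, Nat.mul_mod_left]
    simp [lexBoundary_prod hL]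
  · rw [lexBoundary, mul_comm p, Nat.mul_add_div h, Nat.mul_add_mod, Nat.div_eq_of_lt hr,
      Nat.mod_eq_of_lt hr, add_zero]

/-- `lexBoundary L` is subadditive modulo `L.prod`. -/
theorem lexBoundary_subadditive {L : List ℕ} (hL : ∀ k ∈ L, 2 ≤ k) : ∀ {a b : ℕ}, a ≤ L.prod →
    b ≤ L.prod → (a + b ≤ L.prod → lexBoundary L (a + b) ≤ lexBoundary L a + lexBoundary L b) ∧
      (L.prod ≤ a + b → lexBoundary L (a + b - L.prod) ≤ lexBoundary L a + lexBoundary L b) := by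
  induction L with
  | nil => intros; simp [lexBoundary]
  | cons k L ih =>
    intro a b ha hb
    have hL' : ∀ k ∈ L, 2 ≤ k := fun x hx => hL x (List.mem_cons_of_mem _ hx)
    have hN := prod_pos_of_two_le hL'
    have hfull := lexBoundary_prod hL
    rcases ha.eq_or_lt with rfl | ha
    · rw [hfull, Nat.add_sub_cancel_left]
      refine ⟨fun h => ?_, fun _ => by simp⟩
      obtain rfl : b = 0 := by omega
      rw [add_zero, hfull, lexBoundary_zero, add_zero]
    rcases hb.eq_or_lt with rfl | hb
    · rw [hfull, Nat.add_sub_cancel]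
      refine ⟨fun h => ?_, fun _ => by simp⟩
      obtain rfl : a = 0 := by omega
      rw [zero_add, hfull, lexBoundary_zero, add_zero]
    rw [List.prod_cons] at ha hb ⊢
    obtain ⟨p, r, hr, hp, rfl⟩ : ∃ p r, r < L.prod ∧ p < k ∧ a = p * L.prod + r :=
      ⟨a / L.prod, a % L.prod, Nat.mod_lt _ hN, Nat.div_lt_of_lt_mul (by linarith),
        (Nat.div_add_mod' a _).symm⟩
    obtain ⟨q, s, hs, hq, rfl⟩ : ∃ p r, r < L.prod ∧ p < k ∧ b = p * L.prod + r :=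
      ⟨b / L.prod, b % L.prod, Nat.mod_lt _ hN, Nat.div_lt_of_lt_mul (by linarith),
        (Nat.div_add_mod' b _).symm⟩
    have key := ih hL' hr.le hs.le
    have hcons := fun (p r : ℕ) (h : r ≤ L.prod) => lexBoundary_cons (k := k) hL' p h
    generalize L.prod = N at *
    rw [hcons p r hr.le, hcons q s hs.le]
    have hrs : (0 : ℚ) ≤ N - r := by rw [sub_nonneg]; exact_mod_cast hr.le
    have hss : (0 : ℚ) ≤ N - s := by rw [sub_nonneg]; exact_mod_cast hs.le
    have hr0 : (0 : ℚ) ≤ r := by positivity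
    have hs0 : (0 : ℚ) ≤ s := by positivity
    have hp' : (p : ℚ) + 1 ≤ k := by exact_mod_cast hp
    have hq' : (q : ℚ) + 1 ≤ k := by exact_mod_cast hq
    have hp0 : (0 : ℚ) ≤ p := by positivity
    have hq0 : (0 : ℚ) ≤ q := by positivity
    -- Without a carry, the `N` fibres in the slow direction split into `r` with counts `(p + 1,
    -- q)`, `s` with `(p, q + 1)` and `N - r - s` with `(p, q)`; the one-line inequalities are added
    -- with these weights.
    rcases lt_or_ge (r + s) N with hc | hc
    · have hc' : (0 : ℚ) ≤ N - (r + s) := by rw [sub_nonneg]; exact_mod_cast hc.le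
      have e : p * N + r + (q * N + s) = (p + q) * N + (r + s) := by ring
      constructor
      · intro _
        rw [e, hcons _ _ hc.le]
        have h1 := mul_le_mul_of_nonneg_left
          (lineBoundary_add_le k (p := p + 1) (q := q) (by linarith) hq0) hr0
        have h2 := mul_le_mul_of_nonneg_left
          (lineBoundary_add_le k (p := p) (q := q + 1) hp0 (by linarith)) hs0
        have h3 := mul_le_mul_of_nonneg_left (lineBoundary_add_le k (p := p) (q := q) hp0 hq0) hc'
        rw [show (p : ℚ) + 1 + q = p + q + 1 by ring] at h1
        rw [show (p : ℚ) + (q + 1) = p + q + 1 by ring] at h2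
        push_cast
        linarith [key.1 hc.le]
      · intro h
        rw [e] at h ⊢
        have hpq : k ≤ p + q := by
          by_contra! hcon
          have : (p + q + 1) * N ≤ k * N := Nat.mul_le_mul_right _ hcon
          linarith
        have e' : (p + q) * N + (r + s) - k * N = (p + q - k) * N + (r + s) := by
          rw [Nat.sub_mul, Nat.sub_add_comm (Nat.mul_le_mul_right _ hpq)]
        rw [e', hcons _ _ hc.le]
        have h1 := mul_le_mul_of_nonneg_left
          (lineBoundary_add_sub_le k (p := p + 1) (q := q) hp' (by linarith)) hr0
        have h2 := mul_le_mul_of_nonneg_left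
          (lineBoundary_add_sub_le k (p := p) (q := q + 1) (by linarith) hq') hs0
        have h3 := mul_le_mul_of_nonneg_left
          (lineBoundary_add_sub_le k (p := p) (q := q) (by linarith) (by linarith)) hc'
        rw [show (p : ℚ) + 1 + q - k = p + q - k + 1 by ring] at h1
        rw [show (p : ℚ) + (q + 1) - k = p + q - k + 1 by ring] at h2
        rw [Nat.cast_sub hpq]
        push_cast
        linarith [key.1 hc.le]
    -- With a carry, the weights are `N - s`, `N - r` and `v = r + s - N`, the last for the fibres
    -- with counts `(p + 1, q + 1)`.
    · obtain ⟨v, hv⟩ := Nat.exists_eq_add_of_le hc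
      have hvN : v < N := by omega
      have hv0 : (0 : ℚ) ≤ v := by positivity
      have hvr : (v : ℚ) = r + s - N := by
        have : ((r + s : ℕ) : ℚ) = (N + v : ℕ) := by rw [hv]
        push_cast at this
        linarith
      have e : p * N + r + (q * N + s) = (p + q + 1) * N + v := by
        rw [show p * N + r + (q * N + s) = (p + q) * N + (r + s) by ring, hv]; ring
      have hkey := key.2 hc
      rw [show r + s - N = v by omega] at hkey
      constructor
      · intro _
        rw [e, hcons _ _ hvN.le]
        have h1 := mul_le_mul_of_nonneg_left (lineBoundary_add_le k (p := p + 1) (q := q)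
          (by linarith) hq0) hss
        have h2 := mul_le_mul_of_nonneg_left (lineBoundary_add_le k (p := p) (q := q + 1)
          hp0 (by linarith)) hrs
        have h3 := mul_le_mul_of_nonneg_left (lineBoundary_add_le k (p := p + 1) (q := q + 1)
          (by linarith) (by linarith)) hv0
        rw [show (p : ℚ) + 1 + q = p + q + 1 by ring] at h1
        rw [show (p : ℚ) + (q + 1) = p + q + 1 by ring] at h2
        rw [show (p : ℚ) + 1 + (q + 1) = p + q + 1 + 1 by ring] at h3
        push_cast
        rw [hvr] at h3 ⊢
        linarith
      · intro h
        rw [e] at h ⊢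
        have hpq : k ≤ p + q + 1 := by
          by_contra! hcon
          have : (p + q + 1 + 1) * N ≤ k * N := Nat.mul_le_mul_right _ hcon
          linarith
        have e' : (p + q + 1) * N + v - k * N = (p + q + 1 - k) * N + v := by
          rw [Nat.sub_mul, Nat.sub_add_comm (Nat.mul_le_mul_right _ hpq)]
        rw [e', hcons _ _ hvN.le]
        have h1 := mul_le_mul_of_nonneg_left (lineBoundary_add_sub_le k (p := p + 1) (q := q)
          hp' (by linarith)) hss
        have h2 := mul_le_mul_of_nonneg_left (lineBoundary_add_sub_le k (p := p) (q := q + 1)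
          (by linarith) hq') hrs
        have h3 := mul_le_mul_of_nonneg_left (lineBoundary_add_sub_le k (p := p + 1)
          (q := q + 1) hp' hq') hv0
        rw [show (p : ℚ) + 1 + q - k = p + q + 1 - k by ring] at h1
        rw [show (p : ℚ) + (q + 1) - k = p + q + 1 - k by ring] at h2
        rw [show (p : ℚ) + 1 + (q + 1) - k = p + q + 1 - k + 1 by ring] at h3
        rw [Nat.cast_sub hpq]
        push_cast
        rw [hvr] at h3 ⊢
        linarith

/-! ### The two-dimensional case and the linear form of the slice inequality -/

/-- Twice the weighted sum of an antitone sequence is the sum of its absolute differences. -/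
lemma sum_sum_abs_sub_of_antitone {n : ℕ} {a : Fin n → ℚ} (ha : Antitone a) :
    ∑ t, ∑ u, |a t - a u| = 2 * ∑ t : Fin n, ((n : ℚ) - 1 - 2 * (t : ℕ)) * a t := by
  have hsign : ∀ t u : Fin n, |a t - a u| =
      ((if t < u then 1 else 0) - (if u < t then 1 else 0)) * (a t - a u) := by
    intro t u
    rcases lt_trichotomy t u with h | rfl | h
    · have := ha h.le
      simp [h, h.not_gt, abs_of_nonneg (sub_nonneg.2 this)]
    · simp
    · have := ha h.le
      simp [h, h.not_gt, abs_of_nonpos (sub_nonpos.2 this)]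
  have hcount : ∀ t : Fin n, ∑ u : Fin n, (((if t < u then 1 else 0) : ℚ) -
      (if u < t then 1 else 0)) = (n : ℚ) - 1 - 2 * (t : ℕ) := by
    intro t
    have h1 : (Finset.univ.filter fun u : Fin n => t < u) = Finset.Ioi t := by ext; simp
    have h2 : (Finset.univ.filter fun u : Fin n => u < t) = Finset.Iio t := by ext; simp
    rw [sum_sub_distrib, sum_boole, sum_boole, h1, h2, Fin.card_Ioi, Fin.card_Iio]
    have := t.isLt
    rw [Nat.sub_sub, Nat.cast_sub (by omega)]
    push_cast
    ring
  simp only [hsign, mul_sub, sum_sub_distrib]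
  have hswap : ∑ t : Fin n, ∑ u : Fin n,
      (((if t < u then 1 else 0) : ℚ) - (if u < t then 1 else 0)) * a u =
      - ∑ t : Fin n, ∑ u : Fin n,
        (((if t < u then 1 else 0) : ℚ) - (if u < t then 1 else 0)) * a t := by
    rw [sum_comm, ← sum_neg_distrib]
    refine sum_congr rfl fun t _ => ?_
    rw [← sum_neg_distrib]
    exact sum_congr rfl fun u _ => by ring
  rw [hswap]
  simp only [← sum_mul, hcount]
  ring

/-- The two-dimensional case. -/
theorem lexBoundary_pair_le {T k : ℕ} (hk : 2 ≤ k) (hT : k ≤ T) (a : Fin T → ℕ)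
    (ha : ∀ t, a t ≤ k) : lexBoundary [T, k] (∑ t, a t) ≤
      ∑ t, lineBoundary k (a t) +
        (∑ t, ∑ u, |(a t : ℚ) - a u|) / 2 / (T ^ 2 / 4 : ℕ) := by
  have hv := quarter_pos (hk.trans hT)
  have hw := quarter_pos hk
  have hkq : (0 : ℚ) < k := by exact_mod_cast (by omega : 0 < k)
  have h := le_energy hk hT univ (fun t => (a t : ℤ))
    (fun t _ => ⟨by positivity, by exact_mod_cast ha t⟩) (by simp)
  rw [pairEnergy_eq] at h
  simp only [card_univ, Fintype.card_fin, remProd] at h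
  obtain ⟨m, hm⟩ : ∃ m, m = ∑ t, a t := ⟨_, rfl⟩
  have e1 : ∑ t, (a t : ℤ) = m := by rw [hm]; push_cast; rfl
  obtain ⟨D, hD⟩ : ∃ D, D = ∑ t, ∑ u, |(a t : ℤ) - a u| := ⟨_, rfl⟩
  have e2 : ∑ t, ∑ u, |(a t : ℚ) - a u| = D := by rw [hD]; push_cast; rfl
  obtain ⟨A, hA⟩ : ∃ A, A = ∑ t, (a t : ℤ) ^ 2 := ⟨_, rfl⟩
  have e3 : ∑ t, (a t : ℤ) * (k - a t) = k * m - A := by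
    rw [hA, ← e1, mul_sum, ← sum_sub_distrib]
    exact sum_congr rfl fun t _ => by ring
  have e4 : ∑ t, lineBoundary k (a t) = (k * m - A) / (k ^ 2 / 4 : ℕ) := by
    have : ((∑ t, (a t : ℤ) * (k - a t) : ℤ) : ℚ) = ((k * m - A : ℤ) : ℚ) := by rw [e3]
    push_cast at this
    simp only [lineBoundary, ← sum_div]
    rw [this]
  rw [e3, ← hD, ← hA, e1] at h
  have hr : (m : ℤ) % k = (m % k : ℕ) := by push_cast; rfl
  have hpr : ((m / k : ℕ) : ℚ) * k + (m % k : ℕ) = m := by exact_mod_cast Nat.div_add_mod' m k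
  rw [hr] at h
  rw [← hm, e2, e4]
  simp only [lexBoundary, lineBoundary, List.prod_cons, List.prod_nil, mul_one, Nat.div_one,
    Nat.mod_one, Nat.cast_one, Nat.cast_zero, sub_zero, zero_mul, zero_add, add_zero, one_mul]
  have hq : ((2 * ((k * (T ^ 2 / 4 : ℕ) : ℤ) - (k ^ 2 / 4 : ℕ)) *
      ((m % k : ℕ) * (k - (m % k : ℕ))) : ℤ) : ℚ) ≤
      ((2 * ((k * (T ^ 2 / 4 : ℕ) : ℤ) - T * (k ^ 2 / 4 : ℕ)) * (k * m - A) +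
        (k ^ 2 / 4 : ℕ) * (k * D - (2 * T * A - 2 * m ^ 2)) : ℤ) : ℚ) := by exact_mod_cast h
  simp only [Int.cast_add, Int.cast_sub, Int.cast_mul, Int.cast_pow, Int.cast_natCast,
    Int.cast_ofNat] at hq
  generalize ((T ^ 2 / 4 : ℕ) : ℚ) = v at *
  generalize ((k ^ 2 / 4 : ℕ) : ℚ) = w at *
  generalize ((m / k : ℕ) : ℚ) = p at *
  generalize ((m % k : ℕ) : ℚ) = r at *
  have l1 : r * ((p + 1) * (T - (p + 1)) / v) + (k - r) * (p * (T - p) / v) + r * (k - r) / w =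
      (k * w * (r * ((p + 1) * (T - (p + 1))) + (k - r) * (p * (T - p))) +
        k * v * (r * (k - r))) / (k * v * w) := by
    field_simp
  have l2 : ((k : ℚ) * m - A) / w + D / 2 / v =
      (k * v * (k * m - A) + k * w * D / 2) / (k * v * w) := by
    field_simp
  rw [l1, l2]
  refine div_le_div_of_nonneg_right ?_ (by positivity)
  rw [← hpr] at hq ⊢
  linarith

/-- The weight of position `t` on a line with `k` points: an initial segment of the line has
total weight equal to its normalized boundary. -/
def slope (k t : ℕ) : ℚ := ((k : ℚ) - 1 - 2 * t) / (k ^ 2 / 4 : ℕ)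

lemma sum_slope_mul_of_antitone {k : ℕ} {a : Fin k → ℕ} (ha : Antitone a) :
    ∑ t : Fin k, slope k t * a t = (∑ t, ∑ u, |(a t : ℚ) - a u|) / 2 / (k ^ 2 / 4 : ℕ) := by
  rw [sum_sum_abs_sub_of_antitone (a := fun t => (a t : ℚ)) fun t u h => Nat.cast_le.2 (ha h)]
  simp only [slope, div_mul_eq_mul_div, ← sum_div]
  ring

/-- Slices of initial segments, placed in decreasing order of size, have at least the boundary of
the initial segment of the box with one more coordinate. -/
def LexOptimal (k : ℕ) (L : List ℕ) : Prop :=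
  ∀ a : Fin k → ℕ, Antitone a → (∀ t, a t ≤ L.prod) →
    lexBoundary (k :: L) (∑ t, a t) ≤ ∑ t : Fin k, (lexBoundary L (a t) + slope k t * a t)

/-- Equality holds: on values `0` and `1` the absolute difference is its own square, so both sides
depend only on the total. -/
lemma lexOptimal_nil (k : ℕ) : LexOptimal k [] := by
  intro a ha h1
  have h01 : ∀ t u, |(a t : ℚ) - a u| = ((a t : ℚ) - a u) ^ 2 := by
    intro t u
    have h2 : a t = 0 ∨ a t = 1 := by have := h1 t; simp at this; omega
    have h3 : a u = 0 ∨ a u = 1 := by have := h1 u; simp at this; omega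
    rcases h2 with h2 | h2 <;> rcases h3 with h3 | h3 <;> simp [h2, h3]
  have hsq : ∀ t, (a t : ℚ) ^ 2 = a t := by
    intro t
    have h2 : a t = 0 ∨ a t = 1 := by have := h1 t; simp at this; omega
    rcases h2 with h2 | h2 <;> simp [h2]
  rw [sum_add_distrib, sum_slope_mul_of_antitone ha]
  simp only [h01, sum_sum_sub_sq, hsq]
  simp only [lexBoundary, lineBoundary, List.prod_nil, Nat.div_one, Nat.mod_one, Nat.cast_zero,
    Nat.cast_one, zero_mul, zero_add, sub_zero, one_mul, add_zero, sum_const_zero, card_univ,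
    Fintype.card_fin, Nat.cast_sum]
  apply le_of_eq
  ring

/-! ### Arrays of block sizes and their compression -/

/-- The part of an initial segment of size `a` in block `y`, the blocks having size `N`. -/
def lexColumn (N a y : ℕ) : ℕ := min N (a - y * N)

lemma exists_eq_mul_add {N k a : ℕ} (hN : 0 < N) (hk : 0 < k) (ha : a ≤ k * N) :
    ∃ p r, r ≤ N ∧ p < k ∧ a = p * N + r := by
  rcases ha.eq_or_lt with rfl | ha
  · refine ⟨k - 1, N, le_rfl, by omega, ?_⟩
    rw [← Nat.succ_mul, Nat.succ_eq_add_one, Nat.sub_add_cancel hk]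
  · exact ⟨a / N, a % N, (Nat.mod_lt _ hN).le, Nat.div_lt_of_lt_mul (by linarith),
      (Nat.div_add_mod' a N).symm⟩

/-- Blocks before `p` are full, block `p` holds `r`, and later blocks vanish from the sum by `hg`.
-/
lemma sum_lexColumn {M : Type*} [AddCommMonoid M] {N r p k : ℕ} (hr : r ≤ N) (hp : p < k)
    (g : ℕ → ℕ → M) (hg : ∀ y, g y 0 = 0) :
    ∑ y : Fin k, g y (lexColumn N (p * N + r) y) = ∑ y ∈ range p, g y N + g p r := by
  rw [Fin.sum_univ_eq_sum_range (fun y => g y (lexColumn N (p * N + r) y))]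
  induction k, hp using Nat.le_induction with
  | base =>
    rw [sum_range_succ]
    congr 1
    · refine sum_congr rfl fun y hy => ?_
      have : (y + 1) * N ≤ p * N := Nat.mul_le_mul_right _ (mem_range.1 hy)
      rw [lexColumn, min_eq_left]
      rw [add_mul, one_mul] at this
      omega
    · simp [lexColumn, hr]
  | succ k hk ih =>
    have : (p + 1) * N ≤ k * N := Nat.mul_le_mul_right _ hk
    rw [add_mul, one_mul] at this
    rw [sum_range_succ, ih, lexColumn, show p * N + r - k * N = 0 by omega, Nat.min_zero, hg,
      add_zero]

lemma lexColumn_le (N a y : ℕ) : lexColumn N a y ≤ N := min_le_left _ _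

lemma lexColumn_mono {N a b y z : ℕ} (hab : a ≤ b) (hyz : z ≤ y) :
    lexColumn N a y ≤ lexColumn N b z := by
  have : z * N ≤ y * N := Nat.mul_le_mul_right _ hyz
  simp only [lexColumn]
  omega

lemma sum_lexColumn_eq {N a k : ℕ} (hN : 0 < N) (hk : 0 < k) (ha : a ≤ k * N) :
    ∑ y : Fin k, lexColumn N a y = a := by
  obtain ⟨p, r, hr, hp, rfl⟩ := exists_eq_mul_add hN hk ha
  rw [sum_lexColumn hr hp (fun _ v => v) (fun _ => rfl)]
  simp

lemma sum_range_slope (k p : ℕ) : ∑ y ∈ range p, slope k y = lineBoundary k p := by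
  induction p with
  | zero => simp
  | succ p ih =>
    rw [sum_range_succ, ih]
    simp only [lineBoundary, slope]
    push_cast
    ring

lemma sum_lexColumn_boundary {k a : ℕ} {L : List ℕ} (hL : ∀ k ∈ L, 2 ≤ k) (hk : 0 < k)
    (ha : a ≤ k * L.prod) : ∑ y : Fin k, (lexBoundary L (lexColumn L.prod a y) +
      slope k y * lexColumn L.prod a y) = lexBoundary (k :: L) a := by
  obtain ⟨p, r, hr, hp, rfl⟩ := exists_eq_mul_add (prod_pos_of_two_le hL) hk ha
  rw [sum_lexColumn hr hp (fun y v => lexBoundary L v + slope k y * (v : ℚ)) (by simp),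
    lexBoundary_cons hL p hr, lexBoundary_prod hL]
  simp only [zero_add, ← sum_mul, sum_range_slope]
  simp only [lineBoundary, slope]
  ring

/-- The number of positions at which `F` is neither `0` nor `N`. -/
def numPartial {ι : Type*} [Fintype ι] (N : ℕ) (F : ι → ℕ) : ℕ :=
  ∑ c, if 0 < F c ∧ F c < N then 1 else 0

lemma numPartial_lexColumn_le_one {N a k : ℕ} (hN : 0 < N) (hk : 0 < k) (ha : a ≤ k * N) :
    numPartial N (fun y : Fin k => lexColumn N a y) ≤ 1 := by
  obtain ⟨p, r, hr, hp, rfl⟩ := exists_eq_mul_add hN hk ha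
  rw [numPartial, sum_lexColumn hr hp (fun _ v => if 0 < v ∧ v < N then 1 else 0) (by simp)]
  simp only [lt_irrefl, and_false, if_false, sum_const_zero, zero_add]
  split_ifs <;> omega

lemma numPartial_eq_zero_iff {ι : Type*} [Fintype ι] {N : ℕ} {F : ι → ℕ} :
    numPartial N F = 0 ↔ ∀ c, ¬ (0 < F c ∧ F c < N) := by
  simp [numPartial]

lemma numPartial_prod {ι κ : Type*} [Fintype ι] [Fintype κ] (N : ℕ) (F : ι × κ → ℕ) :
    numPartial N F = ∑ t, numPartial N fun y => F (t, y) :=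
  Fintype.sum_prod_type _

/-- Without partial entries the total is divisible by `N`, so repacking creates none; otherwise
repacking leaves at most one. -/
lemma numPartial_lexColumn_le {N k : ℕ} (hN : 0 < N) (hk : 0 < k) {f : Fin k → ℕ}
    (hf : ∀ y, f y ≤ N) :
    numPartial N (fun y : Fin k => lexColumn N (∑ z, f z) y) ≤ numPartial N f := by
  have ha : ∑ z, f z ≤ k * N := by
    simpa using sum_le_card_nsmul univ f N fun y _ => hf y
  rcases Nat.eq_zero_or_pos (numPartial N f) with h | h
  · rw [h, Nat.le_zero]
    have h' := numPartial_eq_zero_iff.1 h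
    have hdvd : N ∣ ∑ z, f z := dvd_sum fun y _ => by
      have h1 := h' y
      have h2 := hf y
      rcases Nat.eq_zero_or_pos (f y) with h3 | h3
      · rw [h3]; exact dvd_zero N
      · rw [show f y = N by omega]
    obtain ⟨p, r, hr, hp, e⟩ := exists_eq_mul_add hN hk ha
    rw [e] at hdvd ⊢
    have hr' : N ∣ r := (Nat.dvd_add_right (Dvd.intro_left p rfl)).1 hdvd
    rw [numPartial, sum_lexColumn hr hp (fun _ v => if 0 < v ∧ v < N then 1 else 0) (by simp)]
    simp only [lt_irrefl, and_false, if_false, sum_const_zero, zero_add]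
    rw [if_neg]
    rintro ⟨h1, h2⟩
    exact absurd (Nat.le_of_dvd h1 hr') (by omega)
  · exact (numPartial_lexColumn_le_one hN hk ha).trans h

/-- The weighted boundary of a monotone arrangement of initial segments in a `k₁ × k₂` grid. -/
def gridEnergy (k₁ k₂ : ℕ) (L : List ℕ) (F : Fin k₁ × Fin k₂ → ℕ) : ℚ :=
  ∑ c, (lexBoundary L (F c) + (slope k₁ c.1 + slope k₂ c.2) * F c)

lemma gridEnergy_eq (k₁ k₂ : ℕ) (L : List ℕ) (F : Fin k₁ × Fin k₂ → ℕ) :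
    gridEnergy k₁ k₂ L F = ∑ t : Fin k₁, (∑ y : Fin k₂, (lexBoundary L (F (t, y)) +
      slope k₂ y * F (t, y)) + slope k₁ t * (∑ y, F (t, y) : ℕ)) := by
  rw [gridEnergy, Fintype.sum_prod_type]
  refine sum_congr rfl fun t _ => ?_
  push_cast
  rw [mul_sum, ← sum_add_distrib]
  exact sum_congr rfl fun y _ => by ring

/-- Compressing the columns of a grid with two partial cells in one column. -/
lemma exists_column_compression {k₁ k₂ : ℕ} {L : List ℕ} (hL : ∀ k ∈ L, 2 ≤ k) (hk : 0 < k₂)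
    (hopt : LexOptimal k₂ L) {F : Fin k₁ × Fin k₂ → ℕ} (hF : Antitone F) (hN : ∀ c, F c ≤ L.prod)
    {t : Fin k₁} {y z : Fin k₂} (hyz : y ≠ z) (hy : 0 < F (t, y) ∧ F (t, y) < L.prod)
    (hz : 0 < F (t, z) ∧ F (t, z) < L.prod) :
    ∃ F' : Fin k₁ × Fin k₂ → ℕ, Antitone F' ∧ (∀ c, F' c ≤ L.prod) ∧ ∑ c, F' c = ∑ c, F c ∧
      gridEnergy k₁ k₂ L F' ≤ gridEnergy k₁ k₂ L F ∧
      numPartial L.prod F' < numPartial L.prod F := by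
  have hpos := prod_pos_of_two_le hL
  have hcol : ∀ t, ∑ z, F (t, z) ≤ k₂ * L.prod := fun t => by
    simpa using sum_le_card_nsmul univ (fun z => F (t, z)) L.prod fun y _ => hN (t, y)
  refine ⟨fun c => lexColumn L.prod (∑ z, F (c.1, z)) c.2, ?_, fun c => lexColumn_le _ _ _,
    ?_, ?_, ?_⟩
  · intro c c' h
    exact lexColumn_mono (sum_le_sum fun z _ => hF (Prod.mk_le_mk.2 ⟨h.1, le_rfl⟩)) h.2
  · rw [Fintype.sum_prod_type, Fintype.sum_prod_type]
    exact sum_congr rfl fun t _ => sum_lexColumn_eq hpos hk (hcol t)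
  · rw [gridEnergy_eq, gridEnergy_eq]
    refine sum_le_sum fun t _ => ?_
    dsimp only
    rw [sum_lexColumn_boundary hL hk (hcol t), sum_lexColumn_eq hpos hk (hcol t)]
    gcongr
    exact hopt (fun y => F (t, y)) (fun y z h => hF (Prod.mk_le_mk.2 ⟨le_rfl, h⟩))
      fun y => hN (t, y)
  · rw [numPartial_prod, numPartial_prod]
    have hle : ∀ t, numPartial L.prod (fun y : Fin k₂ => lexColumn L.prod (∑ z, F (t, z)) y) ≤
        numPartial L.prod fun y => F (t, y) :=
      fun t => numPartial_lexColumn_le (f := fun y => F (t, y)) hpos hk fun y => hN (t, y)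
    -- Column `t` had two partial cells and keeps at most one.
    refine sum_lt_sum (fun t _ => hle t) ⟨t, mem_univ t, ?_⟩
    refine (numPartial_lexColumn_le_one hpos hk (hcol t)).trans_lt ?_
    have h2 := sum_le_sum_of_subset (f := fun y => if 0 < F (t, y) ∧ F (t, y) < L.prod then 1 else 0)
      (subset_univ {y, z})
    rw [sum_pair hyz, if_pos hy, if_pos hz] at h2
    exact h2

lemma gridEnergy_swap (k₁ k₂ : ℕ) (L : List ℕ) (F : Fin k₁ × Fin k₂ → ℕ) :
    gridEnergy k₂ k₁ L (fun c => F c.swap) = gridEnergy k₁ k₂ L F := by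
  rw [gridEnergy, gridEnergy, ← (Equiv.prodComm (Fin k₁) (Fin k₂)).sum_comp]
  exact sum_congr rfl fun c _ => by simp [add_comm (slope k₁ _)]

lemma exists_row_compression {k₁ k₂ : ℕ} {L : List ℕ} (hL : ∀ k ∈ L, 2 ≤ k) (hk : 0 < k₁)
    (hopt : LexOptimal k₁ L) {F : Fin k₁ × Fin k₂ → ℕ} (hF : Antitone F) (hN : ∀ c, F c ≤ L.prod)
    {t u : Fin k₁} {y : Fin k₂} (htu : t ≠ u) (ht : 0 < F (t, y) ∧ F (t, y) < L.prod)
    (hu : 0 < F (u, y) ∧ F (u, y) < L.prod) :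
    ∃ F' : Fin k₁ × Fin k₂ → ℕ, Antitone F' ∧ (∀ c, F' c ≤ L.prod) ∧ ∑ c, F' c = ∑ c, F c ∧
      gridEnergy k₁ k₂ L F' ≤ gridEnergy k₁ k₂ L F ∧
      numPartial L.prod F' < numPartial L.prod F := by
  obtain ⟨F', h1, h2, h3, h4, h5⟩ := exists_column_compression (F := fun c => F c.swap) hL hk hopt
    (fun c c' h => hF (Prod.swap_le_swap.2 h)) (fun c => hN _) htu ht hu
  have hsum : ∀ g : Fin k₁ × Fin k₂ → ℕ, ∑ c : Fin k₂ × Fin k₁, g c.swap = ∑ c, g c :=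
    fun g => (Equiv.prodComm (Fin k₂) (Fin k₁)).sum_comp g
  refine ⟨fun c => F' c.swap, fun c c' h => h1 (Prod.swap_le_swap.2 h), fun c => h2 _, ?_, ?_, ?_⟩
  · rw [← hsum F, ← h3, ← hsum]; simp
  · rw [gridEnergy_swap] at h4
    rwa [gridEnergy_swap]
  · have e1 := hsum fun c => if 0 < F c ∧ F c < L.prod then 1 else 0
    have e2 := hsum fun c => if 0 < F' c.swap ∧ F' c.swap < L.prod then 1 else 0
    simp only [Prod.swap_swap] at e2
    simp only [numPartial] at h5 ⊢
    rwa [← e1, ← e2]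

lemma sum_update_update {ι M : Type*} [Fintype ι] [DecidableEq ι] [AddCommMonoid M] {c c' : ι}
    (hc : c ≠ c') (F : ι → ℕ) (α β : ℕ) (g : ι → ℕ → M) :
    ∑ x, g x (Function.update (Function.update F c α) c' β x) + (g c (F c) + g c' (F c')) =
      ∑ x, g x (F x) + (g c α + g c' β) := by
  have hm : c' ∈ univ.erase c := mem_erase.2 ⟨hc.symm, mem_univ _⟩
  rw [← add_sum_erase univ (fun x => g x (F x)) (mem_univ c),
    ← add_sum_erase univ (fun x => g x (Function.update (Function.update F c α) c' β x))
      (mem_univ c),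
    ← add_sum_erase (univ.erase c) (fun x => g x (F x)) hm,
    ← add_sum_erase (univ.erase c)
      (fun x => g x (Function.update (Function.update F c α) c' β x)) hm]
  have : ∑ x ∈ (univ.erase c).erase c', g x (Function.update (Function.update F c α) c' β x) =
      ∑ x ∈ (univ.erase c).erase c', g x (F x) := by
    refine sum_congr rfl fun x hx => ?_
    simp only [mem_erase, mem_univ, and_true] at hx
    rw [Function.update_of_ne hx.1, Function.update_of_ne hx.2]
  simp only [this, Function.update_self, Function.update_of_ne hc]
  abel

lemma antitone_update {ι : Type*} [PartialOrder ι] [DecidableEq ι] {F : ι → ℕ} (hF : Antitone F)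
    {N α : ℕ} {c : ι} (hlt : ∀ x < c, F x = N) (hgt : ∀ x, c < x → F x = 0) (hα : α ≤ N) :
    Antitone (Function.update F c α) := by
  intro x y hxy
  rcases eq_or_ne x c with rfl | hx
  · rcases eq_or_ne y x with rfl | hy
    · rfl
    · rw [Function.update_of_ne hy, hgt y (lt_of_le_of_ne hxy hy.symm)]
      exact Nat.zero_le _
  · rw [Function.update_of_ne hx]
    rcases eq_or_ne y c with rfl | hy
    · rwa [Function.update_self, hlt x (lt_of_le_of_ne hxy hx)]
    · rw [Function.update_of_ne hy]
      exact hF hxy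

/-- Merging two partial cells that are comparable to no other partial cell. -/
lemma exists_merge {k₁ k₂ : ℕ} {L : List ℕ} (hL : ∀ k ∈ L, 2 ≤ k) {F : Fin k₁ × Fin k₂ → ℕ}
    (hF : Antitone F) (hN : ∀ c, F c ≤ L.prod)
    (hcorner : ∀ c, 0 < F c ∧ F c < L.prod → (∀ x < c, F x = L.prod) ∧ ∀ x, c < x → F x = 0)
    {c c' : Fin k₁ × Fin k₂} (hcc : c ≠ c') (hc : 0 < F c ∧ F c < L.prod)
    (hc' : 0 < F c' ∧ F c' < L.prod)
    (hle : slope k₁ c.1 + slope k₂ c.2 ≤ slope k₁ c'.1 + slope k₂ c'.2) :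
    ∃ F' : Fin k₁ × Fin k₂ → ℕ, Antitone F' ∧ (∀ c, F' c ≤ L.prod) ∧ ∑ c, F' c = ∑ c, F c ∧
      gridEnergy k₁ k₂ L F' ≤ gridEnergy k₁ k₂ L F ∧
      numPartial L.prod F' < numPartial L.prod F := by
  -- Points move from `c'` to `c`, the cell of smaller slope, until `c'` is empty or `c` is full.
  obtain ⟨α, β, hsum, hα, hβ, hαF, hpart, hen⟩ : ∃ α β, α + β = F c + F c' ∧ α ≤ L.prod ∧
      β ≤ L.prod ∧ F c ≤ α ∧ ((¬ (0 < α ∧ α < L.prod)) ∨ ¬ (0 < β ∧ β < L.prod)) ∧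
      lexBoundary L α + lexBoundary L β ≤ lexBoundary L (F c) + lexBoundary L (F c') := by
    have hsub := lexBoundary_subadditive hL (hN c) (hN c')
    rcases le_total (F c + F c') L.prod with h | h
    · exact ⟨F c + F c', 0, rfl, h, by omega, by omega, by omega, by simpa using hsub.1 h⟩
    · exact ⟨L.prod, F c + F c' - L.prod, by omega, le_rfl, by omega, by omega, by omega,
        by simpa [lexBoundary_prod hL] using hsub.2 h⟩
  have hlt : ¬ c < c' := fun h => by have := (hcorner c hc).2 c' h; omega
  have hgt : ¬ c' < c := fun h => by have := (hcorner c' hc').2 c h; omega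
  refine ⟨Function.update (Function.update F c α) c' β, ?_, ?_, ?_, ?_, ?_⟩
  · refine antitone_update (N := L.prod) (antitone_update hF (hcorner c hc).1 (hcorner c hc).2 hα)
      (fun x hx => ?_) (fun x hx => ?_) hβ
    · rw [Function.update_of_ne (by rintro rfl; exact hlt hx)]
      exact (hcorner c' hc').1 x hx
    · rw [Function.update_of_ne (by rintro rfl; exact hgt hx)]
      exact (hcorner c' hc').2 x hx
  · intro x
    simp only [Function.update_apply]
    split_ifs
    exacts [hβ, hα, hN x]
  · have := sum_update_update hcc F α β fun _ v => v
    omega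
  · have := sum_update_update hcc F α β fun x v =>
      lexBoundary L v + (slope k₁ x.1 + slope k₂ x.2) * (v : ℚ)
    simp only [gridEnergy]
    have h1 : (α : ℚ) + β = F c + F c' := by exact_mod_cast hsum
    have h2 : (F c : ℚ) ≤ α := by exact_mod_cast hαF
    have h3 := mul_le_mul_of_nonneg_right hle (sub_nonneg.2 h2)
    have h4 : (β : ℚ) = F c + F c' - α := by linarith
    rw [h4] at this
    nlinarith
  · have := sum_update_update hcc F α β fun _ v => if 0 < v ∧ v < L.prod then 1 else 0
    simp only [numPartial]
    rw [if_pos hc, if_pos hc'] at this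
    have h : (if 0 < α ∧ α < L.prod then 1 else 0) + (if 0 < β ∧ β < L.prod then 1 else 0) ≤ 1 := by
      rcases hpart with h | h <;> rw [if_neg h] <;> split_ifs <;> simp
    omega

/-- Columns of a 0-1 array are determined by their sums, so `lexBoundary_pair_le` applies, the
interior of each column being handled by `lexOptimal_nil`. -/
lemma lexBoundary_pair_le_of_antitone {k₁ k₂ : ℕ} (hk : 2 ≤ k₂) (h : k₂ ≤ k₁) (P : Fin k₁ × Fin k₂ → ℕ)
    (hP : Antitone P) (h1 : ∀ c, P c ≤ 1) :
    lexBoundary [k₁, k₂] (∑ c, P c) ≤ ∑ c, (slope k₁ c.1 + slope k₂ c.2) * P c := by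
  have hsum : ∀ t, ∑ y, P (t, y) ≤ k₂ := fun t => by
    simpa using sum_le_card_nsmul univ (fun y => P (t, y)) 1 fun y _ => h1 (t, y)
  have hanti : Antitone fun t => ∑ y, P (t, y) := fun t u htu =>
    sum_le_sum fun y _ => hP (Prod.mk_le_mk.2 ⟨htu, le_rfl⟩)
  have h2 := lexBoundary_pair_le hk h (fun t => ∑ y, P (t, y)) hsum
  rw [← sum_slope_mul_of_antitone hanti, ← sum_add_distrib] at h2
  rw [Fintype.sum_prod_type]
  refine h2.trans ?_
  rw [Fintype.sum_prod_type]
  refine sum_le_sum fun t _ => ?_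
  have h3 := lexOptimal_nil k₂ (fun y => P (t, y))
    (fun y z h => hP (Prod.mk_le_mk.2 ⟨le_rfl, h⟩)) fun y => h1 (t, y)
  simp only [lexBoundary, List.prod_nil, Nat.div_one, Nat.mod_one, Nat.cast_zero,
    Nat.cast_one, zero_mul, zero_add, sub_zero, one_mul, add_zero] at h3
  simp only [add_mul, sum_add_distrib, ← mul_sum, ← Nat.cast_sum]
  linarith

/-- Of the `L.prod` positions inside a block, `v` see a planar initial segment of `j + 1` cells and
the others one of `j` cells. -/
lemma lexBoundary_cons_cons {k₁ k₂ : ℕ} {L : List ℕ} (hL : ∀ k ∈ L, 2 ≤ k) (hk : 2 ≤ k₂) (j : ℕ)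
    {v : ℕ} (hv : v ≤ L.prod) : lexBoundary (k₁ :: k₂ :: L) (j * L.prod + v) =
      lexBoundary L v + (L.prod - v) * lexBoundary [k₁, k₂] j +
        v * lexBoundary [k₁, k₂] (j + 1) := by
  obtain ⟨p, s, hs, rfl⟩ : ∃ p s, s < k₂ ∧ j = p * k₂ + s :=
    ⟨j / k₂, j % k₂, Nat.mod_lt _ (by omega), (Nat.div_add_mod' j k₂).symm⟩
  have hL2 : ∀ k ∈ k₂ :: L, 2 ≤ k := by simpa [hk] using hL
  have hL1 : ∀ k ∈ [k₂], 2 ≤ k := by simpa using hk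
  have hline : ∀ s : ℕ, lexBoundary [k₂] s = lineBoundary k₂ s := by
    intro s; simp [lexBoundary, Nat.mod_one]
  have hsN : (s + 1) * L.prod ≤ k₂ * L.prod := Nat.mul_le_mul_right _ hs
  rw [add_mul, one_mul] at hsN
  have e1 : (p * k₂ + s) * L.prod + v = p * (k₂ :: L).prod + (s * L.prod + v) := by
    rw [List.prod_cons]; ring
  have hp : p * k₂ = p * [k₂].prod := by simp
  rw [e1, lexBoundary_cons hL2 p (by rw [List.prod_cons]; omega), lexBoundary_cons hL s hv,
    add_assoc (p * k₂), hp, lexBoundary_cons hL1 p (by simp; omega),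
    lexBoundary_cons hL1 p (by simp; omega), hline, hline]
  simp only [List.prod_cons, List.prod_nil, mul_one, Nat.cast_mul, Nat.cast_add, Nat.cast_one]
  ring

/-- A monotone arrangement in a grid has at least the boundary of the initial segment. -/
theorem lexBoundary_le_gridEnergy {k₁ k₂ : ℕ} {L : List ℕ} (hL : ∀ k ∈ L, 2 ≤ k) (hk : 2 ≤ k₂)
    (h : k₂ ≤ k₁) (h₁ : LexOptimal k₁ L) (h₂ : LexOptimal k₂ L) (n : ℕ) :
    ∀ F : Fin k₁ × Fin k₂ → ℕ, Antitone F → (∀ c, F c ≤ L.prod) → numPartial L.prod F = n →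
      lexBoundary (k₁ :: k₂ :: L) (∑ c, F c) ≤ gridEnergy k₁ k₂ L F := by
  induction n using Nat.strong_induction_on with
  | _ n ih =>
  intro F hF hN hn
  have step : (∃ F' : Fin k₁ × Fin k₂ → ℕ, Antitone F' ∧ (∀ c, F' c ≤ L.prod) ∧
      ∑ c, F' c = ∑ c, F c ∧ gridEnergy k₁ k₂ L F' ≤ gridEnergy k₁ k₂ L F ∧
      numPartial L.prod F' < numPartial L.prod F) →
      lexBoundary (k₁ :: k₂ :: L) (∑ c, F c) ≤ gridEnergy k₁ k₂ L F := by
    rintro ⟨F', a, b, e, l, m⟩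
    rw [← e]
    exact (ih _ (hn ▸ m) F' a b rfl).trans l
  by_cases hcol : ∃ t y z, y ≠ z ∧ (0 < F (t, y) ∧ F (t, y) < L.prod) ∧
      (0 < F (t, z) ∧ F (t, z) < L.prod)
  · obtain ⟨t, y, z, hyz, hy, hz⟩ := hcol
    exact step (exists_column_compression hL (by omega) h₂ hF hN hyz hy hz)
  by_cases hrow : ∃ y t u, t ≠ u ∧ (0 < F (t, y) ∧ F (t, y) < L.prod) ∧
      (0 < F (u, y) ∧ F (u, y) < L.prod)
  · obtain ⟨y, t, u, htu, ht, hu⟩ := hrow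
    exact step (exists_row_compression hL (by omega) h₁ hF hN htu ht hu)
  by_cases htwo : ∃ c c', c ≠ c' ∧ (0 < F c ∧ F c < L.prod) ∧ (0 < F c' ∧ F c' < L.prod)
  · obtain ⟨c, c', hcc, hc, hc'⟩ := htwo
    push Not at hcol hrow
    -- A partial cell is now alone in its row and its column, so monotonicity forces full cells
    -- before it and empty cells after it.
    have hcorner : ∀ c, 0 < F c ∧ F c < L.prod →
        (∀ x < c, F x = L.prod) ∧ ∀ x, c < x → F x = 0 := by
      rintro ⟨t, y⟩ hc
      have below : ∀ z < y, F (t, z) = L.prod := fun z hz => by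
        have h1 := hF (show (t, z) ≤ (t, y) from ⟨le_rfl, hz.le⟩)
        have h2 := hcol t y z hz.ne' hc
        have h3 := hN (t, z)
        omega
      have left : ∀ u < t, F (u, y) = L.prod := fun u hu => by
        have h1 := hF (show (u, y) ≤ (t, y) from ⟨hu.le, le_rfl⟩)
        have h2 := hrow y t u hu.ne' hc
        have h3 := hN (u, y)
        omega
      have above : ∀ z, y < z → F (t, z) = 0 := fun z hz => by
        have h1 := hF (show (t, y) ≤ (t, z) from ⟨le_rfl, hz.le⟩)
        have h2 := hcol t y z hz.ne hc
        omega
      have right : ∀ u, t < u → F (u, y) = 0 := fun u hu => by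
        have h1 := hF (show (t, y) ≤ (u, y) from ⟨hu.le, le_rfl⟩)
        have h2 := hrow y t u hu.ne hc
        omega
      refine ⟨?_, ?_⟩
      · rintro ⟨u, z⟩ hx
        refine le_antisymm (hN _) ?_
        rcases Prod.lt_iff.1 hx with ⟨h1, h2⟩ | ⟨h1, h2⟩
        · rw [← left u h1]; exact hF ⟨le_rfl, h2⟩
        · rw [← below z h2]; exact hF ⟨h1, le_rfl⟩
      · rintro ⟨u, z⟩ hx
        refine Nat.le_zero.1 ?_
        rcases Prod.lt_iff.1 hx with ⟨h1, h2⟩ | ⟨h1, h2⟩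
        · rw [← right u h1]; exact hF ⟨le_rfl, h2⟩
        · rw [← above z h2]; exact hF ⟨h1, le_rfl⟩
    rcases le_total (slope k₁ c.1 + slope k₂ c.2) (slope k₁ c'.1 + slope k₂ c'.2) with hle | hle
    · exact step (exists_merge hL hF hN hcorner hcc hc hc' hle)
    · exact step (exists_merge hL hF hN hcorner hcc.symm hc' hc hle)
  push Not at htwo
  have hpos := prod_pos_of_two_le hL
  -- `D` marks the full cells, `E` the nonempty ones
  set D : Fin k₁ × Fin k₂ → ℕ := fun c => if F c = L.prod then 1 else 0 with hD
  set E : Fin k₁ × Fin k₂ → ℕ := fun c => if 0 < F c then 1 else 0 with hE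
  have hDa : Antitone D := fun c c' hcc => by
    have h1 := hF hcc
    have h2 := hN c
    simp only [hD]
    split_ifs <;> omega
  have hEa : Antitone E := fun c c' hcc => by
    have h1 := hF hcc
    simp only [hE]
    split_ifs <;> omega
  have hD1 := lexBoundary_pair_le_of_antitone hk h D hDa
    (fun c => by simp only [hD]; split_ifs <;> omega)
  have hE1 := lexBoundary_pair_le_of_antitone hk h E hEa
    (fun c => by simp only [hE]; split_ifs <;> omega)
  -- Here `v` is the content of the only partial cell, or `0` if there is none.
  obtain ⟨v, hv, hdecomp, hcount, hbd⟩ : ∃ v ≤ L.prod,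
      (∀ c, (F c : ℚ) = (L.prod - v) * D c + v * E c) ∧
      (v = 0 ∨ ∑ c, E c = ∑ c, D c + 1) ∧ ∑ c, lexBoundary L (F c) = lexBoundary L v := by
    by_cases hp : ∃ c, 0 < F c ∧ F c < L.prod
    · obtain ⟨c₀, h0⟩ := hp
      have hother : ∀ c, c ≠ c₀ → F c = 0 ∨ F c = L.prod := fun c hc => by
        have h1 := htwo c₀ c hc.symm h0
        have h2 := hN c
        omega
      refine ⟨F c₀, hN c₀, fun c => ?_, Or.inr ?_, ?_⟩
      · by_cases hc : c = c₀
        · subst hc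
          simp [hD, hE, h0.1, h0.2.ne]
        · rcases hother c hc with h1 | h1
          · simp [hD, hE, h1, hpos.ne]
          · simp [hD, hE, h1, hpos]
      · have : ∀ c, E c = D c + if c = c₀ then 1 else 0 := by
          intro c
          by_cases hc : c = c₀
          · subst hc
            simp [hD, hE, h0.1, h0.2.ne]
          · rcases hother c hc with h1 | h1
            · simp [hD, hE, h1, hpos.ne, hc]
            · simp [hD, hE, h1, hpos, hc]
        simp only [this, sum_add_distrib]
        simp
      · rw [sum_eq_single c₀]
        · intro c _ hc
          rcases hother c hc with h1 | h1 <;> simp [h1, lexBoundary_prod hL]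
        · simp
    · push Not at hp
      have hother : ∀ c, F c = 0 ∨ F c = L.prod := fun c => by
        have h1 := hp c
        have h2 := hN c
        omega
      refine ⟨0, by omega, fun c => ?_, Or.inl rfl, ?_⟩
      · rcases hother c with h1 | h1
        · simp [hD, h1, hpos.ne]
        · simp [hD, h1]
      · rw [lexBoundary_zero]
        refine sum_eq_zero fun c _ => ?_
        rcases hother c with h1 | h1 <;> simp [h1, lexBoundary_prod hL]
  have hsumF : ∑ c, F c = (∑ c, D c) * L.prod + v := by
    have e : ((∑ c, F c : ℕ) : ℚ) = ((∑ c, D c) * L.prod + v : ℕ) := by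
      rw [Nat.cast_sum, sum_congr rfl fun c _ => hdecomp c, sum_add_distrib, ← mul_sum, ← mul_sum,
        ← Nat.cast_sum, ← Nat.cast_sum]
      rcases hcount with rfl | hc
      · push_cast [-Nat.cast_sum, -Nat.cast_list_prod]; ring
      · rw [hc]; push_cast [-Nat.cast_sum, -Nat.cast_list_prod]; ring
    exact_mod_cast e
  have henergy : gridEnergy k₁ k₂ L F = lexBoundary L v +
      (L.prod - v) * ∑ c, (slope k₁ c.1 + slope k₂ c.2) * D c +
      v * ∑ c, (slope k₁ c.1 + slope k₂ c.2) * E c := by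
    rw [gridEnergy, sum_add_distrib, hbd, add_assoc, mul_sum, mul_sum, ← sum_add_distrib]
    congr 1
    refine sum_congr rfl fun c _ => ?_
    rw [hdecomp c]
    ring
  rw [hsumF, henergy, lexBoundary_cons_cons hL hk _ hv]
  have hv' : (0 : ℚ) ≤ L.prod - v := by rw [sub_nonneg]; exact_mod_cast hv
  have hA := mul_le_mul_of_nonneg_left hD1 hv'
  have hB : (v : ℚ) * lexBoundary [k₁, k₂] (∑ c, D c + 1) ≤
      v * ∑ c, (slope k₁ c.1 + slope k₂ c.2) * E c := by
    rcases hcount with rfl | hc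
    · simp
    · rw [← hc]
      exact mul_le_mul_of_nonneg_left hE1 (by positivity)
  linarith

/-- The weighted edge-isoperimetric theorem for boxes, in terms of slices. -/
theorem lexOptimal (L : List ℕ) : ∀ k, (∀ x ∈ k :: L, 2 ≤ x) → (k :: L).Pairwise (· ≥ ·) →
    LexOptimal k L := by
  induction L with
  | nil => exact fun k _ _ => lexOptimal_nil k
  | cons k₂ L ih =>
    intro k₁ h2 hs a ha hN
    have hL : ∀ x ∈ L, 2 ≤ x := fun x hx => h2 x (by simp [hx])
    have hpos := prod_pos_of_two_le hL
    have hk₂ : 2 ≤ k₂ := h2 k₂ (by simp)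
    simp only [List.pairwise_cons, List.mem_cons, forall_eq_or_imp] at hs
    have o₁ := ih k₁ (by simp only [List.mem_cons, forall_eq_or_imp] at h2 ⊢; exact ⟨h2.1, hL⟩)
      (List.pairwise_cons.2 ⟨hs.1.2, hs.2.2⟩)
    have o₂ := ih k₂ (by simp only [List.mem_cons, forall_eq_or_imp] at h2 ⊢; exact ⟨hk₂, hL⟩)
      (List.pairwise_cons.2 hs.2)
    simp only [List.prod_cons] at hN
    -- Each slice is taken to be an initial segment of its box and is cut into blocks; this array is
    -- antitone because `a` is.
    have key := lexBoundary_le_gridEnergy hL hk₂ hs.1.1 o₁ o₂ _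
      (fun c => lexColumn L.prod (a c.1) c.2) (fun c c' h => lexColumn_mono (ha h.1) h.2)
      (fun c => lexColumn_le _ _ _) rfl
    rw [gridEnergy_eq, Fintype.sum_prod_type] at key
    simp only [sum_lexColumn_boundary hL (show 0 < k₂ by omega) (hN _),
      sum_lexColumn_eq hpos (show 0 < k₂ by omega) (hN _)] at key
    exact key

/-- The isoperimetric inequality for slices in arbitrary order. -/
theorem lexBoundary_le_of_slices {k : ℕ} {L : List ℕ} (h2 : ∀ x ∈ k :: L, 2 ≤ x)
    (hs : (k :: L).Pairwise (· ≥ ·)) (a : Fin k → ℕ) (ha : ∀ t, a t ≤ L.prod) :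
    lexBoundary (k :: L) (∑ t, a t) ≤ ∑ t, lexBoundary L (a t) +
      (∑ t, ∑ u, |(a t : ℚ) - a u|) / 2 / (k ^ 2 / 4 : ℕ) := by
  obtain ⟨σ, hσ⟩ : ∃ σ : Equiv.Perm (Fin k), Antitone (a ∘ σ) := by
    refine ⟨Fin.revPerm.trans (Tuple.sort a), ?_⟩
    exact (Tuple.monotone_sort a).comp_antitone Fin.rev_anti
  have h := lexOptimal L k h2 hs (a ∘ σ) hσ fun t => ha _
  rw [sum_add_distrib, sum_slope_mul_of_antitone hσ] at h
  simp only [Function.comp_apply] at h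
  rw [Equiv.sum_comp σ a, Equiv.sum_comp σ fun t => lexBoundary L (a t),
    Equiv.sum_comp σ fun t => ∑ u, |(a t : ℚ) - a (σ u)|] at h
  have hin : ∀ t, ∑ u, |(a t : ℚ) - a (σ u)| = ∑ u, |(a t : ℚ) - a u| :=
    fun t => Equiv.sum_comp σ fun u => |(a t : ℚ) - a u|
  simpa only [hin] using h

/-! ### Cuts of Cartesian products and their slices -/

/-- The indicator of the ordered pairs that are counted by `cutSize`. -/
noncomputable def cutIndicator {V : Type*} (G : SimpleGraph V) (S : Finset V) (u v : V) : ℕ :=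
  open Classical in if u ∈ S ∧ v ∉ S ∧ G.Adj u v then 1 else 0

lemma cutSize_eq_sum {V : Type*} [Fintype V] (G : SimpleGraph V) (S : Finset V) :
    cutSize G S = ∑ u, ∑ v, cutIndicator G S u v := by
  classical
  simp only [cutIndicator]
  rw [cutSize, SimpleGraph.interedges, Rel.interedges, ← Fintype.sum_prod_type', ← sum_filter,
    ← card_eq_sum_ones]
  congr 1
  ext p
  simp [and_assoc]

lemma cutSize_eq_zero {V : Type*} [Fintype V] (G : SimpleGraph V) {S : Finset V}
    (h : S = ∅ ∨ S = univ) : cutSize G S = 0 := by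
  rw [cutSize_eq_sum]
  rcases h with rfl | rfl <;> simp [cutIndicator]

lemma cutSize_eq_one {V : Type*} [Fintype V] {G : SimpleGraph V} {S : Finset V} {a b : V}
    (ha : a ∈ S) (hb : b ∉ S) (hab : G.Adj a b)
    (h : ∀ u ∈ S, ∀ v ∉ S, G.Adj u v → u = a ∧ v = b) : cutSize G S = 1 := by
  classical
  rw [cutSize, card_eq_one]
  refine ⟨(a, b), ?_⟩
  ext ⟨u, v⟩
  simp only [SimpleGraph.interedges, Rel.interedges, mem_filter, mem_product, mem_compl,
    mem_singleton, Prod.mk.injEq]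
  constructor
  · rintro ⟨⟨hu, hv⟩, huv⟩
    exact h u hu v hv huv
  · rintro ⟨rfl, rfl⟩
    exact ⟨⟨ha, hb⟩, hab⟩

lemma one_le_cutSize {V : Type*} [Fintype V] {G : SimpleGraph V} (hG : G.Preconnected)
    {S : Finset V} (h0 : S.Nonempty) (h1 : S ≠ univ) : 1 ≤ cutSize G S := by
  classical
  obtain ⟨a, ha⟩ := h0
  obtain ⟨b, hb⟩ : ∃ b, b ∉ S := by
    by_contra! h
    exact h1 (eq_univ_iff_forall.2 h)
  obtain ⟨p⟩ := hG a b
  obtain ⟨e, -, h2, h3⟩ := p.exists_boundary_dart (S : Set V) (by simpa using ha) (by simpa using hb)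
  rw [cutSize, Nat.one_le_iff_ne_zero, ← Nat.pos_iff_ne_zero, card_pos]
  refine ⟨(e.fst, e.snd), ?_⟩
  simp only [SimpleGraph.interedges, Rel.interedges, mem_filter, mem_product, mem_compl]
  exact ⟨⟨by simpa using h2, by simpa using h3⟩, e.adj⟩

section Slices

variable {d : ℕ} {V : Fin (d + 1) → Type*}

lemma cartesianProduct_adj_cons (G : ∀ i, SimpleGraph (V i)) (t u : V 0)
    (x y : ∀ i : Fin d, V i.succ) :
    (cartesianProduct G).Adj (Fin.cons t x) (Fin.cons u y) ↔
      ((G 0).Adj t u ∧ x = y) ∨ (t = u ∧ (cartesianProduct fun i => G i.succ).Adj x y) := by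
  simp only [cartesianProduct, Fin.exists_fin_succ, Fin.forall_fin_succ, Fin.cons_zero,
    Fin.cons_succ, ne_eq, not_true_eq_false, false_implies, true_and, Fin.succ_ne_zero,
    not_false_eq_true, true_implies, funext_iff, (Fin.succ_ne_zero _).symm, Fin.succ_inj]
  refine or_congr Iff.rfl ⟨?_, ?_⟩
  · rintro ⟨i, h1, h2, h3⟩
    exact ⟨h2, i, h1, h3⟩
  · rintro ⟨h2, i, h1, h3⟩
    exact ⟨i, h1, h2, h3⟩

variable [∀ i, Fintype (V i)]

/-- The points of `S` on the line in direction `0` through `x`. -/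
noncomputable def lineSlice (S : Finset (∀ i, V i)) (x : ∀ i : Fin d, V i.succ) : Finset (V 0) :=
  open Classical in univ.filter fun t => (Fin.cons t x : ∀ i, V i) ∈ S

/-- The section of `S` at first coordinate `t`. -/
noncomputable def tailSlice (S : Finset (∀ i, V i)) (t : V 0) : Finset (∀ i : Fin d, V i.succ) :=
  open Classical in univ.filter fun x => (Fin.cons t x : ∀ i, V i) ∈ S

@[simp] lemma mem_lineSlice {S : Finset (∀ i, V i)} {x : ∀ i : Fin d, V i.succ} {t : V 0} :
    t ∈ lineSlice S x ↔ (Fin.cons t x : ∀ i, V i) ∈ S := by simp [lineSlice]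

@[simp] lemma mem_tailSlice {S : Finset (∀ i, V i)} {x : ∀ i : Fin d, V i.succ} {t : V 0} :
    x ∈ tailSlice S t ↔ (Fin.cons t x : ∀ i, V i) ∈ S := by simp [tailSlice]

lemma sum_cons {M : Type*} [AddCommMonoid M] (g : (∀ i, V i) → M) :
    ∑ x, g x = ∑ t : V 0, ∑ x : ∀ i : Fin d, V i.succ, g (Fin.cons t x) := by
  rw [← (Fin.consEquiv V).sum_comp, Fintype.sum_prod_type]
  rfl

lemma card_eq_sum_tailSlice (S : Finset (∀ i, V i)) : S.card = ∑ t, (tailSlice S t).card := by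
  classical
  have : S.card = ∑ x, if x ∈ S then 1 else 0 := by simp
  rw [this, sum_cons]
  refine sum_congr rfl fun t _ => ?_
  rw [← sum_filter, ← card_eq_sum_ones, tailSlice]

/-- The cut of a Cartesian product splits into the cuts of the lines in direction `0` and the
cuts of the sections. -/
lemma cutSize_cartesianProduct (G : ∀ i, SimpleGraph (V i)) (S : Finset (∀ i, V i)) :
    cutSize (cartesianProduct G) S = ∑ x, cutSize (G 0) (lineSlice S x) +
      ∑ t, cutSize (cartesianProduct fun i => G i.succ) (tailSlice S t) := by
  classical
  have key : ∀ (t u : V 0) (x y : ∀ i : Fin d, V i.succ),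
      cutIndicator (cartesianProduct G) S (Fin.cons t x) (Fin.cons u y) =
      (if x = y then cutIndicator (G 0) (lineSlice S x) t u else 0) +
      (if t = u then cutIndicator (cartesianProduct fun i => G i.succ) (tailSlice S t) x y
        else 0) := by
    intro t u x y
    simp only [cutIndicator, mem_lineSlice, mem_tailSlice, cartesianProduct_adj_cons]
    by_cases hxy : x = y
    · subst hxy
      by_cases htu : t = u
      · subst htu; simp
      · simp [htu]
    · by_cases htu : t = u
      · subst htu; simp [hxy]
      · simp [htu, hxy]
  simp only [cutSize_eq_sum]
  rw [sum_cons, sum_congr rfl fun t _ => sum_congr rfl fun x _ => sum_cons _]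
  simp only [key, sum_add_distrib]
  congr 1
  · rw [sum_comm]
    refine sum_congr rfl fun x _ => sum_congr rfl fun t _ => sum_congr rfl fun u _ => ?_
    simp
  · refine sum_congr rfl fun t _ => sum_congr rfl fun x _ => ?_
    rw [sum_comm]
    refine sum_congr rfl fun y _ => ?_
    simp

end Slices

/-! ### The lower bound for cuts of products of connected graphs -/

lemma lineBoundary_le_one {k c : ℕ} (hk : 2 ≤ k) (hc : c ≤ k) : lineBoundary k c ≤ 1 := by
  rw [lineBoundary, div_le_one (quarter_pos hk), ← Nat.cast_sub hc, ← Nat.cast_mul, Nat.cast_le,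
    Nat.le_div_iff_mul_le (by norm_num)]
  obtain ⟨b, rfl⟩ := Nat.exists_eq_add_of_le hc
  rw [Nat.add_sub_cancel_left]
  zify
  nlinarith [sq_nonneg ((c : ℤ) - b)]

lemma lineBoundary_le_cutSize {k : ℕ} (hk : 2 ≤ k) {G : SimpleGraph (Fin k)} (hG : G.Preconnected)
    (S : Finset (Fin k)) : lineBoundary k S.card ≤ cutSize G S := by
  have hc : S.card ≤ k := by simpa using card_le_univ S
  rcases S.eq_empty_or_nonempty with rfl | h0
  · simp
  by_cases h1 : S = univ
  · subst h1; simp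
  exact (lineBoundary_le_one hk hc).trans (by exact_mod_cast one_le_cutSize hG h0 h1)

/-- A difference of cardinalities is at most the size of the symmetric difference; summed over
ordered pairs, each `x` lying in `c` of the sets is counted `2 c (k - c)` times. -/
lemma sum_abs_card_sub_le {α : Type*} [Fintype α] {k : ℕ} (P : Fin k → Finset α) :
    (∑ t, ∑ u, |((P t).card : ℚ) - (P u).card|) / 2 ≤
      ∑ x : α, open Classical in ((univ.filter fun t => x ∈ P t).card : ℚ) *
        (k - (univ.filter fun t => x ∈ P t).card) := by
  classical
  have h1 : ∀ t u, |((P t).card : ℚ) - (P u).card| ≤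
      ∑ x : α, ((if x ∈ P t then (1 : ℚ) else 0) - if x ∈ P u then 1 else 0) ^ 2 := by
    intro t u
    have e : ∀ s, ((P s).card : ℚ) = ∑ x : α, if x ∈ P s then (1 : ℚ) else 0 := by
      intro s; simp
    rw [e, e, ← sum_sub_distrib]
    refine (abs_sum_le_sum_abs _ _).trans (sum_le_sum fun x _ => ?_)
    split_ifs <;> simp
  have h2 : ∑ t, ∑ u, |((P t).card : ℚ) - (P u).card| ≤
      ∑ x : α, ∑ t, ∑ u, ((if x ∈ P t then (1 : ℚ) else 0) - if x ∈ P u then 1 else 0) ^ 2 := by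
    rw [sum_comm]
    simp_rw [sum_comm (s := (univ : Finset α))]
    rw [sum_comm]
    exact sum_le_sum fun t _ => sum_le_sum fun u _ => h1 t u
  have h3 : ∀ x : α, ∑ t, ∑ u, ((if x ∈ P t then (1 : ℚ) else 0) - if x ∈ P u then 1 else 0) ^ 2 =
      2 * (((univ.filter fun t => x ∈ P t).card : ℚ) *
        (k - (univ.filter fun t => x ∈ P t).card)) := by
    intro x
    rw [sum_sum_sub_sq]
    have : ∀ t, (if x ∈ P t then (1 : ℚ) else 0) ^ 2 = if x ∈ P t then (1 : ℚ) else 0 := by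
      intro t; split_ifs <;> simp
    simp only [this, sum_boole, card_univ, Fintype.card_fin]
    ring
  simp only [h3, ← mul_sum] at h2
  linarith

/-- The lower bound for all cuts of a product of connected graphs. -/
theorem lexBoundary_le_cutSize {d : ℕ} : ∀ (k : Fin d → ℕ), (∀ i, 2 ≤ k i) →
    (∀ i j, i ≤ j → k j ≤ k i) → ∀ G : ∀ i, SimpleGraph (Fin (k i)), (∀ i, (G i).Preconnected) →
    ∀ S : Finset (∀ i, Fin (k i)),
      lexBoundary (List.ofFn k) S.card ≤ cutSize (cartesianProduct G) S := by
  induction d with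
  | zero => intro k _ _ G _ S; simp [lexBoundary]
  | succ d ih =>
    intro k hk hmono G hG S
    have h2 : ∀ x ∈ k 0 :: List.ofFn fun i : Fin d => k i.succ, 2 ≤ x := by
      rw [← List.ofFn_succ]
      intro x hx
      obtain ⟨i, rfl⟩ := (List.mem_ofFn' k x).1 hx
      exact hk i
    have hs : (k 0 :: List.ofFn fun i : Fin d => k i.succ).Pairwise (· ≥ ·) := by
      rw [← List.ofFn_succ, List.pairwise_ofFn]
      exact fun i j hij => hmono i j hij.le
    have hcard : ∀ t, (tailSlice S t).card ≤ (List.ofFn fun i : Fin d => k i.succ).prod := by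
      intro t
      refine (card_le_univ _).trans ?_
      simp [List.prod_ofFn]
    have key := lexBoundary_le_of_slices h2 hs (fun t => (tailSlice S t).card) hcard
    rw [List.ofFn_succ, cutSize_cartesianProduct, card_eq_sum_tailSlice]
    refine key.trans ?_
    push_cast
    rw [add_comm]
    refine add_le_add ?_ (sum_le_sum fun t _ => ?_)
    · refine (div_le_div_of_nonneg_right (sum_abs_card_sub_le (tailSlice S))
        (quarter_pos (hk 0)).le).trans ?_
      rw [sum_div]
      refine sum_le_sum fun x _ => ?_
      refine le_trans (le_of_eq ?_) (lineBoundary_le_cutSize (hk 0) (hG 0) (lineSlice S x))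
      simp only [lineBoundary, lineSlice, mem_tailSlice]
    · exact ih (fun i => k i.succ) (fun i => hk _) (fun i j hij => hmono _ _ (Fin.succ_le_succ_iff.2 hij))
        (fun i => G i.succ) (fun i => hG _) _

/-! ### The value at half the points -/

/-- The bisection width of the product, as a function of the list of side lengths. -/
def listPsi : List ℕ → ℕ
  | [] => 0
  | k :: L => if Even k then L.prod else L.prod + listPsi L

/-- For even `k`, half the box is exactly `k / 2` full blocks. For `k = 2 * h + 1` it is `h` full
blocks and half of the next one, and `lineBoundary` equals `1` at both `h` and `h + 1`, so each line
in the slow direction counts `1` and the middle block contributes recursively. -/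
lemma lexBoundary_half {L : List ℕ} (hL : ∀ k ∈ L, 2 ≤ k) :
    lexBoundary L (L.prod / 2) = listPsi L := by
  induction L with
  | nil => simp [lexBoundary, listPsi]
  | cons k L ih =>
    have hL' : ∀ k ∈ L, 2 ≤ k := fun x hx => hL x (List.mem_cons_of_mem _ hx)
    have hq := quarter_pos (hL k (by simp))
    rw [listPsi, List.prod_cons]
    rcases Nat.even_or_odd' k with ⟨h, rfl | rfl⟩
    · rw [if_pos (even_two_mul h), show 2 * h * L.prod / 2 = h * L.prod + 0 by
        rw [mul_assoc, Nat.mul_div_cancel_left _ (by norm_num), add_zero],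
        lexBoundary_cons hL' h (Nat.zero_le _)]
      have : lineBoundary (2 * h) h = 1 := by
        rw [show (2 * h) ^ 2 / 4 = h ^ 2 by
          rw [show (2 * h) ^ 2 = 4 * h ^ 2 by ring, Nat.mul_div_cancel_left _ (by norm_num)]] at hq
        rw [lineBoundary, show (2 * h) ^ 2 / 4 = h ^ 2 by
          rw [show (2 * h) ^ 2 = 4 * h ^ 2 by ring, Nat.mul_div_cancel_left _ (by norm_num)]]
        rw [div_eq_one_iff_eq hq.ne']
        push_cast
        ring
      simp [this]
    · have e4 : (2 * h + 1) ^ 2 / 4 = h * (h + 1) := by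
        rw [show (2 * h + 1) ^ 2 = 4 * (h * (h + 1)) + 1 by ring]; omega
      have hhalf : (2 * h + 1) * L.prod / 2 = h * L.prod + L.prod / 2 := by
        rw [show (2 * h + 1) * L.prod = 2 * (h * L.prod) + L.prod by ring]; omega
      rw [if_neg (by simp), hhalf, lexBoundary_cons hL' h (Nat.div_le_self _ _), ih hL']
      rw [e4] at hq
      have h1 : lineBoundary (2 * h + 1) h = 1 := by
        rw [lineBoundary, e4, div_eq_one_iff_eq hq.ne']
        push_cast
        ring
      have h2 : lineBoundary (2 * h + 1) (h + 1) = 1 := by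
        rw [lineBoundary, e4, div_eq_one_iff_eq hq.ne']
        push_cast
        ring
      rw [h1, h2]
      push_cast
      ring

lemma C_zero {d : ℕ} (k : Fin (d + 1) → ℕ) :
    C k 0 = (List.ofFn fun i : Fin d => k i.succ).prod := by
  rw [C, Fin.prod_Ioi_zero, List.prod_ofFn]

lemma C_succ {d : ℕ} (k : Fin (d + 1) → ℕ) (i : Fin d) : C k i.succ = C (fun i => k i.succ) i :=
  Fin.prod_Ioi_succ _ _

lemma Psi_succ {d : ℕ} (k : Fin (d + 1) → ℕ) (e : ℕ) :
    Psi k (e + 1) = C k 0 + Psi (fun i => k i.succ) e := by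
  simp only [Psi, sum_filter]
  rw [Fin.sum_univ_succ]
  simp [C_succ]

lemma Psi_zero {d : ℕ} (k : Fin d → ℕ) : Psi k 0 = 0 := by simp [Psi]

lemma lowestEvenDim_of_even {d : ℕ} {k : Fin (d + 1) → ℕ} (h : Even (k 0)) :
    lowestEvenDim k = 1 := by
  rw [lowestEvenDim, if_pos ⟨0, h⟩]
  refine le_antisymm (Nat.sInf_le ⟨0, h, rfl⟩) (le_csInf ⟨1, 0, h, rfl⟩ ?_)
  rintro m ⟨i, -, rfl⟩
  omega

lemma lowestEvenDim_of_not_even {d : ℕ} {k : Fin (d + 1) → ℕ} (h : ¬ Even (k 0)) :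
    lowestEvenDim k = lowestEvenDim (fun i => k i.succ) + 1 := by
  simp only [lowestEvenDim]
  by_cases hex : ∃ i : Fin d, Even (k i.succ)
  · have hex' : ∃ i, Even (k i) := let ⟨i, hi⟩ := hex; ⟨i.succ, hi⟩
    rw [if_pos hex, if_pos hex']
    apply le_antisymm
    · obtain ⟨i, hi, e⟩ := Nat.sInf_mem (s := {m : ℕ | ∃ i : Fin d, Even (k i.succ) ∧ m = (i : ℕ) + 1})
        (let ⟨i, hi⟩ := hex; ⟨_, i, hi, rfl⟩)
      rw [e]
      exact Nat.sInf_le ⟨i.succ, hi, by simp⟩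
    · refine le_csInf (let ⟨i, hi⟩ := hex'; ⟨_, i, hi, rfl⟩) ?_
      rintro m ⟨i, hi, rfl⟩
      rcases Fin.eq_zero_or_eq_succ i with rfl | ⟨j, rfl⟩
      · exact absurd hi h
      · have := Nat.sInf_le (s := {m : ℕ | ∃ i : Fin d, Even (k i.succ) ∧ m = (i : ℕ) + 1})
          ⟨j, hi, rfl⟩
        simpa using this
  · have hex' : ¬ ∃ i, Even (k i) := by
      rintro ⟨i, hi⟩
      rcases Fin.eq_zero_or_eq_succ i with rfl | ⟨j, rfl⟩
      · exact h hi
      · exact hex ⟨j, hi⟩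
    rw [if_neg hex, if_neg hex']

lemma Psi_lowestEvenDim {d : ℕ} (k : Fin d → ℕ) :
    Psi k (lowestEvenDim k) = listPsi (List.ofFn k) := by
  induction d with
  | zero => simp [Psi, listPsi]
  | succ d ih =>
    rw [List.ofFn_succ, listPsi]
    split_ifs with h
    · rw [lowestEvenDim_of_even h, Psi_succ k 0, Psi_zero, C_zero, add_zero]
    · rw [lowestEvenDim_of_not_even h, Psi_succ, ih, C_zero]

/-! ### The upper bound from middle cuts -/

/-- `G` can be cut in the middle by one edge: into halves if `k` is even, and on both sides of a
middle vertex if `k` is odd. -/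
def HasMiddleCut {k : ℕ} (G : SimpleGraph (Fin k)) : Prop :=
  (Even k → ∃ A : Finset (Fin k), 2 * A.card = k ∧ cutSize G A = 1) ∧
    (¬ Even k → ∃ (A : Finset (Fin k)) (r : Fin k), r ∉ A ∧ 2 * A.card + 1 = k ∧
      cutSize G A = 1 ∧ cutSize G (insert r A) = 1)

/-- The upper bound: a lexicographic half of the product. -/
theorem exists_cutSize_eq {d : ℕ} : ∀ (k : Fin d → ℕ) (G : ∀ i, SimpleGraph (Fin (k i))),
    (∀ i, HasMiddleCut (G i)) → ∃ S : Finset (∀ i, Fin (k i)),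
      S.card = (List.ofFn k).prod / 2 ∧ cutSize (cartesianProduct G) S = listPsi (List.ofFn k) := by
  classical
  induction d with
  | zero =>
    intro k G _
    exact ⟨∅, by simp, by simp [cutSize_eq_zero, listPsi]⟩
  | succ d ih =>
    intro k G hG
    have hcard : Fintype.card (∀ i : Fin d, Fin (k i.succ)) =
        (List.ofFn fun i : Fin d => k i.succ).prod := by
      simp [List.prod_ofFn]
    rw [List.ofFn_succ, listPsi, List.prod_cons]
    by_cases h : Even (k 0)
    · obtain ⟨A, hA, hcut⟩ := (hG 0).1 h
      have hline : ∀ x, lineSlice (univ.filter fun x : ∀ i, Fin (k i) => x 0 ∈ A) x = A := by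
        intro x; ext t; simp
      have htail : ∀ t, tailSlice (univ.filter fun x : ∀ i, Fin (k i) => x 0 ∈ A) t =
          if t ∈ A then univ else ∅ := by
        intro t; ext x; split_ifs <;> simp [*]
      refine ⟨univ.filter fun x => x 0 ∈ A, ?_, ?_⟩
      · rw [card_eq_sum_tailSlice]
        simp only [htail, apply_ite Finset.card, card_univ, card_empty, hcard]
        rw [← sum_filter, sum_const, smul_eq_mul, filter_mem_eq_inter, univ_inter]
        have : k 0 * (List.ofFn fun i : Fin d => k i.succ).prod =
            2 * (A.card * (List.ofFn fun i : Fin d => k i.succ).prod) := by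
          rw [← mul_assoc, hA]
        omega
      · rw [cutSize_cartesianProduct, if_pos h]
        have h0 : ∀ t, cutSize (cartesianProduct fun i => G i.succ)
            (tailSlice (univ.filter fun x : ∀ i, Fin (k i) => x 0 ∈ A) t) = 0 := by
          intro t
          apply cutSize_eq_zero
          rw [htail]
          split_ifs <;> simp
        simp only [hline, hcut, h0, sum_const_zero, add_zero, sum_const, card_univ, hcard,
          smul_eq_mul, mul_one]
    · obtain ⟨A, r, hr, hA, hcut, hcut'⟩ := (hG 0).2 h
      obtain ⟨S, hS, hSc⟩ := ih (fun i => k i.succ) (fun i => G i.succ) fun i => hG i.succ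
      -- The middle slice carries a half `S` of the remaining product. Lines in direction `0` meet
      -- `T` in `A` or `insert r A`, each costing one edge, and only the slice at `r` has an inner
      -- cut.
      set T : Finset (∀ i, Fin (k i)) :=
        univ.filter fun x => x 0 ∈ A ∨ (x 0 = r ∧ Fin.tail x ∈ S) with hT
      have hline : ∀ x, cutSize (G 0) (lineSlice T x) = 1 := by
        intro x
        by_cases hx : x ∈ S
        · rw [show lineSlice T x = insert r A by ext t; simp [hT, hx, or_comm]]
          exact hcut'
        · rw [show lineSlice T x = A by ext t; simp [hT, hx]]
          exact hcut
      have htailA : ∀ t ∈ A, tailSlice T t = univ := by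
        intro t ht; ext x; simp [hT, ht]
      have htailr : tailSlice T r = S := by
        ext x; simp [hT, hr]
      have htail0 : ∀ t, t ∉ A → t ≠ r → tailSlice T t = ∅ := by
        intro t ht htr; ext x; simp [hT, ht, htr]
      refine ⟨T, ?_, ?_⟩
      · have e : ∀ t, (tailSlice T t).card =
            (if t ∈ A then (List.ofFn fun i : Fin d => k i.succ).prod else 0) +
              if t = r then S.card else 0 := by
          intro t
          by_cases ht : t ∈ A
          · have : t ≠ r := by rintro rfl; exact hr ht
            rw [htailA t ht, if_pos ht, if_neg this, card_univ, hcard, add_zero]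
          · by_cases htr : t = r
            · subst htr; rw [htailr]; simp [ht]
            · rw [htail0 t ht htr]; simp [ht, htr]
        rw [card_eq_sum_tailSlice]
        simp only [e, sum_add_distrib]
        rw [← sum_filter, sum_const, smul_eq_mul, filter_mem_eq_inter, univ_inter]
        simp only [sum_ite_eq', mem_univ, if_true, hS]
        have : k 0 * (List.ofFn fun i : Fin d => k i.succ).prod =
            2 * (A.card * (List.ofFn fun i : Fin d => k i.succ).prod) +
              (List.ofFn fun i : Fin d => k i.succ).prod := by
          rw [← mul_assoc, ← Nat.succ_mul, Nat.succ_eq_add_one, hA]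
        omega
      · rw [cutSize_cartesianProduct, if_neg h, sum_congr rfl fun x _ => hline x,
          sum_eq_single r, htailr, hSc, sum_const, card_univ, hcard, smul_eq_mul, mul_one]
        · intro t _ htr
          apply cutSize_eq_zero
          by_cases ht : t ∈ A
          · exact Or.inr (htailA t ht)
          · exact Or.inl (htail0 t ht htr)
        · simp

/-! ### Middle cuts of paths and complete binary trees -/

lemma cutSize_pathGraph {k h : ℕ} (h0 : 0 < h) (hk : h < k) :
    cutSize (SimpleGraph.pathGraph k) (univ.filter fun v : Fin k => (v : ℕ) < h) = 1 := by
  refine cutSize_eq_one (a := ⟨h - 1, by omega⟩) (b := ⟨h, hk⟩) (by simp; omega) (by simp) ?_ ?_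
  · rw [SimpleGraph.pathGraph_adj]
    left
    simp only
    omega
  · intro u hu v hv huv
    simp only [mem_filter, mem_univ, true_and] at hu hv
    rw [SimpleGraph.pathGraph_adj] at huv
    simp only [Fin.ext_iff]
    omega

lemma card_filter_val_lt {k h : ℕ} (hk : h ≤ k) :
    (univ.filter fun v : Fin k => (v : ℕ) < h).card = h := by
  rw [Fin.card_filter_val_lt]
  omega

lemma hasMiddleCut_pathGraph {k : ℕ} (hk : 2 ≤ k) : HasMiddleCut (SimpleGraph.pathGraph k) := by
  constructor
  · rintro ⟨h, rfl⟩
    exact ⟨_, by rw [card_filter_val_lt (h := h) (by omega)]; omega,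
      cutSize_pathGraph (by omega) (by omega)⟩
  · intro hodd
    obtain ⟨h, rfl⟩ := Nat.not_even_iff_odd.1 hodd
    refine ⟨univ.filter fun v : Fin (2 * h + 1) => (v : ℕ) < h, ⟨h, by omega⟩, by simp,
      by rw [card_filter_val_lt (by omega)], cutSize_pathGraph (by omega) (by omega), ?_⟩
    refine Eq.trans ?_ (cutSize_pathGraph (k := 2 * h + 1) (h := h + 1) (by omega) (by omega))
    congr 1
    ext v
    simp only [mem_insert, mem_filter, mem_univ, true_and, Fin.ext_iff]
    omega

lemma binaryTree_adj {k : ℕ} {u v : Fin k} : (binaryTree k).Adj u v ↔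
    ((v : ℕ) = 2 * u + 1 ∨ (v : ℕ) = 2 * u + 2) ∨ (u : ℕ) = 2 * v + 1 ∨ (u : ℕ) = 2 * v + 2 := by
  rw [binaryTree, SimpleGraph.fromRel_adj, and_iff_right_iff_imp, ne_eq, Fin.ext_iff]
  omega

lemma binaryTree_preconnected (k : ℕ) : (binaryTree k).Preconnected := by
  have h : ∀ (n : ℕ) (hn : n < k), (binaryTree k).Reachable ⟨n, hn⟩ ⟨0, by omega⟩ := by
    intro n
    induction n using Nat.strong_induction_on with
    | _ n ih =>
    intro hn
    rcases Nat.eq_zero_or_pos n with rfl | h0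
    · exact SimpleGraph.Reachable.refl _
    · refine SimpleGraph.Reachable.trans (SimpleGraph.Adj.reachable ?_)
        (ih ((n - 1) / 2) (by omega) (by omega))
      rw [binaryTree_adj]
      simp only
      omega
  exact fun u v => (h u u.isLt).trans (h v v.isLt).symm

/-- The vertices of the left subtree of the root: those whose position in level order, counted
from `1`, lies in the first half of its level. -/
def IsLeft (V : ℕ) : Prop := ∃ l : ℕ, 2 * 2 ^ l ≤ V ∧ V < 3 * 2 ^ l

lemma IsLeft.two_le {V : ℕ} (h : IsLeft V) : 2 ≤ V := by
  obtain ⟨l, h1, -⟩ := h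
  have := Nat.one_le_two_pow (n := l)
  omega

lemma not_isLeft_three : ¬ IsLeft 3 := by
  rintro ⟨l, h1, h2⟩
  rcases l with _ | l
  · simp at h2
  · have := Nat.one_le_two_pow (n := l)
    rw [pow_succ] at h1
    omega

lemma IsLeft.child {V W : ℕ} (h : IsLeft V) (hW : W = 2 * V ∨ W = 2 * V + 1) : IsLeft W := by
  obtain ⟨l, h1, h2⟩ := h
  refine ⟨l + 1, ?_⟩
  rw [pow_succ]
  omega

lemma IsLeft.parent {V W : ℕ} (h : IsLeft W) (hW : W = 2 * V ∨ W = 2 * V + 1) (hV : 2 ≤ V) :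
    IsLeft V := by
  obtain ⟨l, h1, h2⟩ := h
  rcases l with _ | l
  · simp at h1 h2; omega
  · refine ⟨l, ?_⟩
    rw [pow_succ] at h1 h2
    omega

lemma isLeft_two : IsLeft 2 := ⟨0, by norm_num⟩

/-- Each level below the root adds a block of `2 ^ j` left vertices; the added `1` on the left
avoids truncated subtraction. -/
lemma card_filter_isLeft (j : ℕ) : open Classical in
    ((range (2 ^ (j + 1))).filter IsLeft).card + 1 = 2 ^ j := by
  classical
  induction j with
  | zero =>
    rw [filter_eq_empty_iff.2]
    · simp
    · intro V hV hl
      have := hl.two_le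
      simp at hV
      omega
  | succ j ih =>
    have e : (range (2 ^ (j + 1 + 1))).filter IsLeft =
        (range (2 ^ (j + 1))).filter IsLeft ∪ Ico (2 * 2 ^ j) (3 * 2 ^ j) := by
      ext V
      simp only [mem_filter, mem_range, mem_union, mem_Ico]
      have p1 : 2 ^ (j + 1) = 2 * 2 ^ j := by ring
      have p2 : 2 ^ (j + 1 + 1) = 4 * 2 ^ j := by ring
      constructor
      · rintro ⟨hV, hl⟩
        by_cases hlt : V < 2 ^ (j + 1)
        · exact Or.inl ⟨hlt, hl⟩
        · right
          obtain ⟨l, h1, h2⟩ := hl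
          rcases lt_trichotomy l j with h | rfl | h
          · have : 2 ^ (l + 1) ≤ 2 ^ j := Nat.pow_le_pow_right (by norm_num) h
            rw [pow_succ] at this
            omega
          · exact ⟨h1, h2⟩
          · have : 2 ^ (j + 1) ≤ 2 ^ l := Nat.pow_le_pow_right (by norm_num) h
            omega
      · rintro (⟨h1, h2⟩ | h)
        · exact ⟨by omega, h2⟩
        · exact ⟨by omega, j, h⟩
    rw [e, card_union_of_disjoint, Nat.card_Ico]
    · have p1 : 2 ^ (j + 1) = 2 * 2 ^ j := by ring
      omega
    · rw [disjoint_left]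
      intro V h1 h2
      simp only [mem_filter, mem_range, mem_Ico, pow_succ] at h1 h2
      omega

/-- The middle vertex is the root and `A` is its left subtree: the edge to the left child cuts off
`A`, the edge to the right child cuts off `A` together with the root. -/
lemma hasMiddleCut_binaryTree {k : ℕ} (hk : 2 ≤ k) (hj : ∃ j : ℕ, 1 ≤ j ∧ k = 2 ^ j - 1) :
    HasMiddleCut (binaryTree k) := by
  classical
  obtain ⟨j, hj1, hkj⟩ := hj
  obtain ⟨j, rfl⟩ : ∃ i, j = i + 1 := ⟨j - 1, by omega⟩
  have h2j := Nat.one_le_two_pow (n := j)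
  have hpow : 2 ^ (j + 1) = 2 * 2 ^ j := by ring
  -- A number `2 ^ (j + 1) - 1` is odd, so the even case is vacuous.
  refine ⟨fun he => ?_, fun _ => ?_⟩
  · obtain ⟨m, hm⟩ := he
    omega
  have hk3 : 3 ≤ k := by omega
  have hcard : (univ.filter fun v : Fin k => IsLeft (v + 1)).card =
      ((range (2 ^ (j + 1))).filter IsLeft).card := by
    refine card_bij (fun v _ => (v : ℕ) + 1) ?_ ?_ ?_
    · intro v hv
      have := v.isLt
      simp only [mem_filter, mem_univ, true_and, mem_range] at hv ⊢
      exact ⟨by omega, hv⟩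
    · intro u _ v _ huv
      exact Fin.ext (by omega)
    · intro V hV
      simp only [mem_filter, mem_range] at hV
      have := hV.2.two_le
      refine ⟨⟨V - 1, by omega⟩, ?_, ?_⟩
      · simp only [mem_filter, mem_univ, true_and]
        rw [Nat.sub_add_cancel (by omega)]
        exact hV.2
      · simp only
        omega
  have hcount := card_filter_isLeft j
  have h1 : ¬ IsLeft 1 := fun h => by have := h.two_le; omega
  refine ⟨univ.filter fun v : Fin k => IsLeft (v + 1), ⟨0, by omega⟩, by simpa using h1,
    by rw [hcard]; omega, ?_, ?_⟩
  · refine cutSize_eq_one (a := ⟨1, by omega⟩) (b := ⟨0, by omega⟩) (by simpa using isLeft_two)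
      (by simpa using h1) (by rw [binaryTree_adj]; simp) ?_
    intro u hu v hv huv
    simp only [mem_filter, mem_univ, true_and] at hu hv
    rw [binaryTree_adj] at huv
    rcases huv with huv | huv
    · exact absurd (hu.child (W := v + 1) (by omega)) hv
    · by_cases hv0 : (v : ℕ) = 0
      · have hu2 : (u : ℕ) ≠ 2 := fun h => not_isLeft_three (by rw [h] at hu; exact hu)
        simp only [Fin.ext_iff]
        omega
      · exact absurd (hu.parent (V := v + 1) (by omega) (by omega)) hv
  · refine cutSize_eq_one (a := ⟨0, by omega⟩) (b := ⟨2, by omega⟩) (by simp)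
      (by simpa using not_isLeft_three) (by rw [binaryTree_adj]; simp) ?_
    intro u hu v hv huv
    simp only [mem_insert, mem_filter, mem_univ, true_and, not_or, Fin.ext_iff] at hu hv
    rw [binaryTree_adj] at huv
    rcases hu with hu | hu
    · have hv1 : (v : ℕ) ≠ 1 := fun h => hv.2 (by rw [h]; exact isLeft_two)
      simp only [Fin.ext_iff]
      omega
    · exfalso
      rcases huv with huv | huv
      · exact hv.2 (hu.child (by omega))
      · exact hv.2 (hu.parent (V := v + 1) (by omega) (by omega))

end MCTP

theorem mainTheorem1 (d : ℕ) (hd : 1 ≤ d) (k : Fin d → ℕ)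
    (hk : ∀ i, 2 ≤ k i) (hmono : ∀ i j, i ≤ j → k j ≤ k i)
    (G : ∀ i, SimpleGraph (Fin (k i)))
    (hG : ∀ i, MCTP.IsCompleteBinaryTree (G i) ∨ MCTP.IsPathGraph (G i)) :
    MCTP.bisectionWidth (MCTP.cartesianProduct G) = MCTP.Psi k (MCTP.lowestEvenDim k) := by
  have hconn : ∀ i, (G i).Preconnected := by
    intro i
    rcases hG i with ⟨-, h⟩ | h
    · rw [h]; exact MCTP.binaryTree_preconnected _
    · rw [h]
      obtain ⟨n, hn⟩ : ∃ n, k i = n + 1 := ⟨k i - 1, by have := hk i; omega⟩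
      rw [hn]
      exact (SimpleGraph.pathGraph_connected n).preconnected
  have hmid : ∀ i, MCTP.HasMiddleCut (G i) := by
    intro i
    rcases hG i with ⟨hj, h⟩ | h
    · rw [h]; exact MCTP.hasMiddleCut_binaryTree (hk i) hj
    · rw [h]; exact MCTP.hasMiddleCut_pathGraph (hk i)
  have hcard : Fintype.card (∀ i, Fin (k i)) = (List.ofFn k).prod := by simp [List.prod_ofFn]
  obtain ⟨S, hS, hcut⟩ := MCTP.exists_cutSize_eq k G hmid
  rw [MCTP.Psi_lowestEvenDim, MCTP.bisectionWidth, hcard]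
  refine le_antisymm (Nat.sInf_le ⟨S, hS, hcut⟩) (le_csInf ⟨_, S, hS, hcut⟩ ?_)
  rintro c ⟨T, hT, rfl⟩
  have h := MCTP.lexBoundary_le_cutSize k hk hmono G hconn T
  rw [hT, MCTP.lexBoundary_half] at h
  · exact_mod_cast h
  · intro x hx
    obtain ⟨i, rfl⟩ := (List.mem_ofFn' k x).1 hx
    exact hk i
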